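/- Let $\mathbb{C}_+=\{z\in\mathbb{C}:\operatorname{Re}z>0\}$, let $dA$ be Lebesgue measure on $\mathbb{C}_+$, and let $A^2_1(\mathbb{C}_+)$ be the space of holomorphic functions $f$ on $\mathbb{C}_+$ with $\int_{\mathbb{C}_+}|f(z)|^2\operatorname{Re}z\,dA(z)<\infty$, with norm given by $$\|f\|_{A^2_1(\mathbb{C}_+)}^2=2\pi^{1/2}\int_{\mathbb{C}_+}|f(z)|^2\operatorname{Re}z\,dA(z).$$ Fix $t>0$, and endow the space $ze^{-z/t}A^2_1(\mathbb{C}_+)=\{z\mapsto ze^{-z/t}f(z): f\in A^2_1(\mathbb{C}_+)\}$ with the norm $$\|F\|_{\mathcal{G}_2^t}=\pi^{-3/4}\,\bigl\|z^{-1}e^{z/t}F\bigr\|_{A^2_1(\mathbb{C}_+)}.$$ For every $g\in L^2_{\mathbb{C}}((0,t),\tau^2d\tau/t^2)$ and $z\in\mathbb{C}_+$ the integral $$\mathcal{L}_tg(z)=\frac1{t^2}\int_0^t\frac{z}{(t-\tau)^2}\exp\Bigl(-\frac{z}{t-\tau}\Bigr)g(\tau)\,\tau^2\,d\tau$$ converges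 absolutely, and $\mathcal{L}_t$ is an isometric (linear) isomorphism of $L^2_{\mathbb{C}}((0,t),\tau^2d\tau/t^2)$ onto $\bigl(ze^{-z/t}A^2_1(\mathbb{C}_+),\|\cdot\|_{\mathcal{G}_2^t}\bigr)$. Moreover, let $$d\mu^t(z)=2\pi^{-1}|z|^{-2}e^{\frac2t\operatorname{Re}z}\operatorname{Re}z\,dA(z),\qquad z\in\mathbb{C}_+.$$ For every $F\in ze^{-z/t}A^2_1(\mathbb{C}_+)$ and every compact exhaustion $\{E_N\}$ of $\mathbb{C}_+$ (compact sets with $E_N\subset\operatorname{int}E_{N+1}$ and $\bigcup_NE_N=\mathbb{C}_+$), the integrals below converge absolutely for all $N$ and all $\tau\in(0,t)$, they define functions of $\tau$ in $L^2((0,t),\tau^2d\tau/t^2)$, and $$(\mathcal{L}_t)^{-1}F(\tau)=\lim_{N\to\infty}\frac1{(t-\tau)^2}\int_{E_N}\overline{z}\,F(z)\exp\Bigl(-\frac{\overline z}{t-\tau}\Bigr)d\mu^t(z),$$ where the limit is taken in the norm of $L^2((0,t),\tau^2d\tau/t^2)$. -/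

import Mathlib

open MeasureTheory Filter Topology
open scoped ComplexConjugate ENNReal

noncomputable section

/-- The open right half plane `ℂ₊ = {z : Re z > 0}`. As a subtype of `ℂ` it carries the
subspace topology and the Borel σ-algebra. -/
abbrev RightHalfPlane : Type := {z : ℂ // 0 < z.re}

/-- The area measure `dA` on `ℂ₊`: the Lebesgue measure of `ℂ` on subsets of `ℂ₊`. -/
def areaMeasure : Measure RightHalfPlane := Measure.comap Subtype.val (volume : Measure ℂ)

/-- `f : ℂ₊ → ℂ` is holomorphic: it is the restriction to `ℂ₊` of a function that is complex
differentiable at every point of the open set `ℂ₊`. -/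
def IsHolomorphic (f : RightHalfPlane → ℂ) : Prop :=
  ∃ F : ℂ → ℂ, DifferentiableOn ℂ F {z : ℂ | 0 < z.re} ∧ ∀ z : RightHalfPlane, f z = F z

theorem IsHolomorphic.continuous {f : RightHalfPlane → ℂ} (hf : IsHolomorphic f) :
    Continuous f := by
  obtain ⟨F, hF, h⟩ := hf
  have h2 : f = fun z : RightHalfPlane => F z := funext h
  rw [h2]
  exact hF.continuousOn.comp_continuous continuous_subtype_val (fun z => z.2)

/-- The weighted Bergman space `A²₁(ℂ₊)`: the holomorphic `f` on `ℂ₊` with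
`∫ |f(z)|² Re z dA(z) < ∞`. -/
def weightedBergman : Submodule ℂ (RightHalfPlane → ℂ) where
  carrier := {f | IsHolomorphic f ∧
    Integrable (fun z : RightHalfPlane => ‖f z‖ ^ 2 * (z : ℂ).re) areaMeasure}
  zero_mem' := ⟨⟨0, differentiableOn_const 0, fun _ => rfl⟩, by simp⟩
  add_mem' := by
    rintro f g ⟨hf, hfi⟩ ⟨hg, hgi⟩
    have hc : Continuous (f + g) := hf.continuous.add hg.continuous
    refine ⟨?_, ?_⟩
    · obtain ⟨F, hF, hfF⟩ := hf
      obtain ⟨G, hG, hgG⟩ := hg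
      exact ⟨F + G, hF.add hG, fun z => by simp [hfF z, hgG z]⟩
    · refine ((hfi.add hgi).const_mul 2).mono' ?_ (ae_of_all _ fun z => ?_)
      · exact ((hc.norm.pow 2).mul
          (Complex.continuous_re.comp continuous_subtype_val)).aestronglyMeasurable
      · have hz : 0 < (z : ℂ).re := z.2
        rw [Real.norm_of_nonneg (by positivity)]
        have h1 : ‖f z + g z‖ ≤ ‖f z‖ + ‖g z‖ := norm_add_le _ _
        have h2 : ‖f z + g z‖ ^ 2 ≤ 2 * (‖f z‖ ^ 2 + ‖g z‖ ^ 2) := by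
          nlinarith [norm_nonneg (f z + g z), sq_nonneg (‖f z‖ - ‖g z‖)]
        calc ‖(f + g) z‖ ^ 2 * (z : ℂ).re
            ≤ (2 * (‖f z‖ ^ 2 + ‖g z‖ ^ 2)) * (z : ℂ).re :=
              mul_le_mul_of_nonneg_right h2 hz.le
          _ = 2 * (‖f z‖ ^ 2 * (z : ℂ).re + ‖g z‖ ^ 2 * (z : ℂ).re) := by ring
  smul_mem' := by
    rintro c f ⟨⟨F, hF, hfF⟩, hfi⟩
    refine ⟨⟨c • F, hF.const_smul c, fun z => by simp [hfF z]⟩, ?_⟩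
    convert hfi.const_mul (‖c‖ ^ 2) using 2 with z
    simp only [Pi.smul_apply, smul_eq_mul, norm_mul]
    ring

/-- The norm of `A²₁(ℂ₊)`: `‖f‖² = 2 π^{1/2} ∫ |f(z)|² Re z dA(z)`. -/
def bergmanNorm (f : RightHalfPlane → ℂ) : ℝ :=
  Real.sqrt (2 * Real.sqrt Real.pi * ∫ z : RightHalfPlane, ‖f z‖ ^ 2 * (z : ℂ).re ∂areaMeasure)

/-- The space `z e^{-z/t} A²₁(ℂ₊)`: the functions `z ↦ z e^{-z/t} f(z)` with `f ∈ A²₁(ℂ₊)`. -/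
def rangeSpace (t : ℝ) : Submodule ℂ (RightHalfPlane → ℂ) :=
  weightedBergman.map (LinearMap.mulLeft ℂ
    (fun z : RightHalfPlane => (z : ℂ) * Complex.exp (-(z : ℂ) / t)))

/-- The norm of `z e^{-z/t} A²₁(ℂ₊)`: `π^{-3/4}` times the `A²₁(ℂ₊)`-norm of
`z⁻¹ e^{z/t} F(z)`. -/
def rangeNorm (t : ℝ) (F : RightHalfPlane → ℂ) : ℝ :=
  Real.pi ^ (-(3 / 4) : ℝ) *
    bergmanNorm (fun z => (z : ℂ)⁻¹ * Complex.exp ((z : ℂ) / t) * F z)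

/-- The measure `τ² dτ / t²` on the interval `(0, t)`. -/
def sourceMeasure (t : ℝ) : Measure ℝ :=
  (volume.restrict (Set.Ioo 0 t)).withDensity (fun τ => ENNReal.ofReal (τ ^ 2 / t ^ 2))

/-- The integrand `z (t-τ)⁻² e^{-z/(t-τ)} g(τ) τ²` of `L_t g(z)`. -/
def transformIntegrand (t : ℝ) (g : ℝ → ℂ) (z : RightHalfPlane) (τ : ℝ) : ℂ :=
  (z : ℂ) / ((t : ℂ) - τ) ^ 2 * Complex.exp (-((z : ℂ) / ((t : ℂ) - τ))) * g τ * (τ : ℂ) ^ 2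

/-- `L_t g(z) = t⁻² ∫₀ᵗ z (t-τ)⁻² e^{-z/(t-τ)} g(τ) τ² dτ`. -/
def transform (t : ℝ) (g : ℝ → ℂ) (z : RightHalfPlane) : ℂ :=
  1 / (t : ℂ) ^ 2 * ∫ τ in Set.Ioo 0 t, transformIntegrand t g z τ

/-- The measure `dμᵗ(z) = 2 π⁻¹ |z|⁻² e^{(2/t) Re z} Re z dA(z)` on `ℂ₊`. -/
def inversionMeasure (t : ℝ) : Measure RightHalfPlane :=
  areaMeasure.withDensity (fun z => ENNReal.ofReal
    (2 * Real.pi⁻¹ * (‖(z : ℂ)‖ ^ 2)⁻¹ * Real.exp (2 / t * (z : ℂ).re) * (z : ℂ).re))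

/-- The integrand `z̄ F(z) e^{-z̄/(t-τ)}` of the inversion formula. -/
def inversionIntegrand (t : ℝ) (F : RightHalfPlane → ℂ) (τ : ℝ) (z : RightHalfPlane) : ℂ :=
  conj (z : ℂ) * F z * Complex.exp (-(conj (z : ℂ) / ((t : ℂ) - τ)))

/-- The truncated inversion integral
`(t-τ)⁻² ∫_E z̄ F(z) e^{-z̄/(t-τ)} dμᵗ(z)`, as a function of `τ`. -/
def truncatedInverse (t : ℝ) (F : RightHalfPlane → ℂ) (E : Set RightHalfPlane) (τ : ℝ) : ℂ :=
  1 / ((t : ℂ) - τ) ^ 2 * ∫ z in E, inversionIntegrand t F τ z ∂(inversionMeasure t)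

end

/-!
The space `z e^{-z/t} A²₁(ℂ₊)` consists of the holomorphic functions in `L²(μᵗ)`, with the same
norm, and `L_t g(z) = ⟪k_z, g⟫`, where `k_z(τ)` is the conjugate of `z (t-τ)⁻² e^{-z/(t-τ)}`. The
substitution `s = 1/(t-τ) - 1/t` turns `⟪k_z, k_w⟫` into the Laplace integral
`∫₀^∞ s² e^{-(z+w̄)s} ds = 2/(z+w̄)³`, up to the factors `z e^{-z/t}` and `w̄ e^{-w̄/t}`. This is
the reproducing kernel of the holomorphic functions in `L²(μᵗ)`: the Cayley transform carries the
claim to the unit disc, where it is the mean value property. Hence `L_t` is isometric on the span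
of the `k_z`, which is dense because a function orthogonal to all `k_z` with `Re z = 1` has
vanishing Fourier transform in the variable `s`.

An isometry onto a closed subspace of `L²(μᵗ)` is inverted by its adjoint. The adjoint of `L_t`
sends `1_E F`, for compact `E`, to the integral over `E` in the inversion formula, and `1_{E_N} F`
tends to `F` in `L²(μᵗ)`.
-/

noncomputable section

section FourierUniqueness

open scoped FourierTransform

theorem ae_eq_zero_of_fourierIntegral_eq_zero {V E : Type*} [NormedAddCommGroup V]
    [InnerProductSpace ℝ V] [FiniteDimensional ℝ V] [MeasurableSpace V] [BorelSpace V]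
    [NormedAddCommGroup E] [NormedSpace ℂ E] [CompleteSpace E] {μ : Measure V} [SigmaFinite μ]
    {f : V → E} (hf : Integrable f μ)
    (h : ∀ w, VectorFourier.fourierIntegral 𝐞 μ (innerₗ V) f w = 0) : f =ᵐ[μ] 0 := by
  refine ae_eq_zero_of_integral_contDiff_smul_eq_zero hf.locallyIntegrable fun φ hφ hφc => ?_
  let ψ : SchwartzMap V ℂ := (hφc.comp_left (g := Complex.ofReal) rfl).toSchwartzMap
    (Complex.ofRealCLM.contDiff.comp hφ)
  have hψ : 𝓕 (𝓕⁻ ψ : SchwartzMap V ℂ) = ψ := FourierTransform.fourier_fourierInv_eq ψ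
  have hflip := VectorFourier.integral_bilin_fourierIntegral_eq_flip (ν := volume)
    (ContinuousLinearMap.lsmul ℂ ℂ : ℂ →L[ℂ] E →L[ℂ] E).flip Real.continuous_fourierChar
    (L := innerₗ V) continuous_inner hf (𝓕⁻ ψ : SchwartzMap V ℂ).integrable
  have hfourier (x : V) :
      VectorFourier.fourierIntegral 𝐞 volume (innerₗ V).flip (𝓕⁻ ψ : SchwartzMap V ℂ) x = φ x := by
    rw [flip_innerₗ]
    exact DFunLike.congr_fun hψ x
  simpa only [h, map_zero, zero_apply, integral_zero, hfourier,
    ContinuousLinearMap.flip_apply, ContinuousLinearMap.lsmul_apply, Complex.coe_smul,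
    eq_comm (a := (0 : E))] using hflip

theorem ae_eq_zero_of_integral_cexp_comp_eq_zero {α E : Type*} [MeasurableSpace α]
    [NormedAddCommGroup E] [NormedSpace ℂ E] [CompleteSpace E] {μ : Measure α} [SigmaFinite μ]
    {X : α → ℝ} (hX : MeasurableEmbedding X) {f : α → E} (hf : Integrable f μ)
    (h : ∀ w : ℝ, ∫ a, Complex.exp (w * X a * Complex.I) • f a ∂μ = 0) : f =ᵐ[μ] 0 := by
  have hcomp : Function.extend X f 0 ∘ X = f := Function.extend_comp hX.injective f 0
  have hsigma : SigmaFinite (μ.map X) := hX.sigmaFinite_map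
  have hzero : Function.extend X f 0 =ᵐ[μ.map X] 0 := by
    refine ae_eq_zero_of_fourierIntegral_eq_zero
      (hX.integrable_map_iff.2 (by rwa [hcomp])) fun w => ?_
    rw [VectorFourier.fourierIntegral, hX.integral_map, ← h (-(2 * Real.pi * w))]
    congr 1 with a
    rw [hX.injective.extend_apply, Circle.smul_def, Real.fourierChar_apply]
    congr 2
    simp only [innerₗ_apply_apply, RCLike.inner_apply, conj_trivial]
    push_cast
    ring
  rw [← hcomp]
  exact ae_of_ae_map hX.measurable.aemeasurable hzero

end FourierUniqueness

theorem aestronglyMeasurable_deriv_of_isOpen {α E : Type*} [MeasurableSpace α]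
    [NormedAddCommGroup E] [NormedSpace ℂ E] {μ : Measure α} {U : Set ℂ} (hU : IsOpen U)
    {f : ℂ → α → E} (hmeas : ∀ z ∈ U, AEStronglyMeasurable (f z) μ)
    (hdiff : ∀ᵐ a ∂μ, DifferentiableOn ℂ (f · a) U) {z : ℂ} (hz : z ∈ U) :
    AEStronglyMeasurable (fun a => deriv (f · a) z) μ := by
  have : (comap ((↑) : U → ℂ) (𝓝[≠] z)).NeBot := comap_neBot fun s hs =>
    have ⟨w, hws, hwU⟩ := nonempty_of_mem
      (inter_mem hs (mem_nhdsWithin_of_mem_nhds (hU.mem_nhds hz)))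
    ⟨⟨w, hwU⟩, hws⟩
  refine aestronglyMeasurable_of_tendsto_ae (comap ((↑) : U → ℂ) (𝓝[≠] z))
    (f := fun w a => slope (f · a) z w)
    (fun w => ((hmeas w w.2).sub (hmeas z hz)).const_smul ((w : ℂ) - z)⁻¹) ?_
  filter_upwards [hdiff] with a ha
  exact (hasDerivAt_iff_tendsto_slope.1 (ha.hasDerivAt (hU.mem_nhds hz))).comp tendsto_comap

theorem differentiableOn_integral_of_locally_dominated {α E : Type*} [MeasurableSpace α]
    [NormedAddCommGroup E] [NormedSpace ℂ E] {μ : Measure α} {U : Set ℂ} (hU : IsOpen U)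
    {f : ℂ → α → E} (hmeas : ∀ z ∈ U, AEStronglyMeasurable (f z) μ)
    (hdiff : ∀ᵐ a ∂μ, DifferentiableOn ℂ (f · a) U)
    (hbound : ∀ z ∈ U, ∃ s ∈ 𝓝 z, ∃ bound : α → ℝ, Integrable bound μ ∧
      ∀ᵐ a ∂μ, ∀ w ∈ s, ‖f w a‖ ≤ bound a) :
    DifferentiableOn ℂ (fun z => ∫ a, f z a ∂μ) U := by
  intro z hz
  obtain ⟨s, hs, bound, hbound, hfs⟩ := hbound z hz
  obtain ⟨R, hR, hball⟩ := Metric.nhds_basis_closedBall.mem_iff.1 (inter_mem (hU.mem_nhds hz) hs)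
  have hsub {w : ℂ} (hw : w ∈ Metric.ball z (R / 2)) :
      Metric.closedBall w (R / 2) ⊆ Metric.closedBall z R :=
    Metric.closedBall_subset_closedBall' (by linarith [Metric.mem_ball.1 hw])
  have hcauchy : ∀ᵐ a ∂μ, ∀ w ∈ Metric.ball z (R / 2),
      ‖deriv (f · a) w‖ ≤ bound a / (R / 2) := by
    filter_upwards [hdiff, hfs] with a hda hba w hw
    refine Complex.norm_deriv_le_of_forall_mem_sphere_norm_le (half_pos hR) ?_ fun v hv =>
      hba v (hball (hsub hw (Metric.sphere_subset_closedBall hv))).2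
    refine (hda.mono fun v hv => (hball (hsub hw ?_)).1).diffContOnCl
    exact Metric.closure_ball_subset_closedBall hv
  have hderiv := aestronglyMeasurable_deriv_of_isOpen hU hmeas hdiff hz
  refine (hasDerivAt_integral_of_dominated_loc_of_deriv_le (Metric.ball_mem_nhds z (half_pos hR))
    (eventually_of_mem (hU.mem_nhds hz) hmeas) ?_ hderiv hcauchy
    (hbound.div_const _) ?_).2.differentiableAt.differentiableWithinAt
  · exact hbound.mono' (hmeas z hz) (hfs.mono fun a ha => ha z (mem_of_mem_nhds hs))
  · filter_upwards [hdiff] with a ha w hw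
    exact ha.hasDerivAt (hU.mem_nhds
      (hball (hsub hw (Metric.mem_closedBall_self (half_pos hR).le))).1)

theorem tendsto_toLp_indicator {α E ι : Type*} [MeasurableSpace α] {μ : Measure α}
    [NormedAddCommGroup E] {p : ℝ≥0∞} [Fact (1 ≤ p)] (hp : p ≠ ∞) {l : Filter ι}
    [l.IsCountablyGenerated] {s : ι → Set α} (hs : ∀ i, MeasurableSet (s i))
    (hmem : ∀ᵐ x ∂μ, ∀ᶠ i in l, x ∈ s i) {f : α → E} (hf : MemLp f p μ) :
    Tendsto (fun i => (hf.indicator (hs i)).toLp) l (𝓝 hf.toLp) := by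
  have hp0 : p ≠ 0 := (zero_lt_one.trans_le (Fact.out (p := 1 ≤ p))).ne'
  have hp_pos : 0 < p.toReal := ENNReal.toReal_pos hp0 hp
  rw [Lp.tendsto_Lp_iff_tendsto_eLpNorm'']
  simp only [eLpNorm_eq_lintegral_rpow_enorm_toReal hp0 hp]
  have hdom : Tendsto (fun i => ∫⁻ x, ‖((s i).indicator f - f) x‖ₑ ^ p.toReal ∂μ) l
      (𝓝 (∫⁻ _, 0 ∂μ)) := by
    refine tendsto_lintegral_filter_of_dominated_convergence' (fun x => ‖f x‖ₑ ^ p.toReal)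
      (Eventually.of_forall fun i =>
        ((hf.1.indicator (hs i)).sub hf.1).enorm.pow_const _) ?_
      (lintegral_rpow_enorm_lt_top_of_eLpNorm_lt_top hp0 hp hf.2).ne ?_
    · refine Eventually.of_forall fun i => ae_of_all _ fun x => ?_
      gcongr
      by_cases hx : x ∈ s i <;> simp [hx]
    · filter_upwards [hmem] with x hx
      refine tendsto_const_nhds.congr' ?_
      filter_upwards [hx] with i hi
      simp [hi, hp_pos]
  simpa [hp_pos] using hdom.ennrpow_const (1 / p.toReal)

section IntegralOperator

variable {α β : Type*} [MeasurableSpace α] [MeasurableSpace β] {μ : Measure α} {ν : Measure β}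

theorem memLp_integral_of_norm_le [SFinite μ] [IsFiniteMeasure ν] {E : Type*}
    [NormedAddCommGroup E] [NormedSpace ℝ E] {K : β → α → E}
    (hK : AEStronglyMeasurable (Function.uncurry K) (ν.prod μ)) {bound : α → ℝ}
    (hbound : Integrable bound μ) (hle : ∀ᵐ q ∂ν.prod μ, ‖K q.1 q.2‖ ≤ bound q.2) (p : ℝ≥0∞) :
    MemLp (fun y => ∫ x, K y x ∂μ) p ν := by
  refine MemLp.of_bound hK.integral_prod_right' (∫ x, bound x ∂μ) ?_
  filter_upwards [Measure.ae_ae_of_ae_prod hle] with y hy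
  exact norm_integral_le_of_norm_le hbound hy

theorem integrable_prod_mul_of_norm_le [SFinite μ] [SFinite ν] {𝕜 : Type*} [NormedRing 𝕜]
    {K : β → α → 𝕜} (hK : AEStronglyMeasurable (Function.uncurry K) (ν.prod μ)) {bound : α → ℝ}
    (hbound : Integrable bound μ) (hle : ∀ᵐ q ∂ν.prod μ, ‖K q.1 q.2‖ ≤ bound q.2)
    {g : β → 𝕜} (hg : Integrable g ν) :
    Integrable (fun q : β × α => g q.1 * K q.1 q.2) (ν.prod μ) := by
  refine (hg.norm.mul_prod hbound).mono' (hg.1.comp_fst.mul hK) ?_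
  filter_upwards [hle] with q hq
  exact (norm_mul_le _ _).trans (by gcongr)

open ContinuousLinearMap in
theorem adjoint_toLp_eq_toLp_integral [SFinite μ] [SFinite ν] {𝕜 : Type*} [RCLike 𝕜]
    {T : Lp 𝕜 2 ν →L[𝕜] Lp 𝕜 2 μ} {κ : α → β → 𝕜}
    (hT : ∀ g : Lp 𝕜 2 ν, T g =ᵐ[μ] fun x => ∫ y, κ x y * g y ∂ν) {f : α → 𝕜} (hf : MemLp f 2 μ)
    (hTf : MemLp (fun y => ∫ x, f x * conj (κ x y) ∂μ) 2 ν)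
    (hint : ∀ g : Lp 𝕜 2 ν,
      Integrable (fun q : β × α => conj (g q.1) * (f q.2 * conj (κ q.2 q.1))) (ν.prod μ)) :
    adjoint T hf.toLp = hTf.toLp := by
  refine ext_inner_left 𝕜 fun g => ?_
  have hleft : (fun x => inner 𝕜 (T g x) (hf.toLp f x)) =ᵐ[μ]
      fun x => ∫ y, conj (g y) * (f x * conj (κ x y)) ∂ν := by
    filter_upwards [hT g, hf.coeFn_toLp] with x hTx hfx
    rw [hTx, hfx, RCLike.inner_apply, ← integral_conj, ← integral_const_mul]
    congr 1 with y
    rw [map_mul]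
    ring
  have hright : (fun y => inner 𝕜 (g y) (hTf.toLp _ y)) =ᵐ[ν]
      fun y => ∫ x, conj (g y) * (f x * conj (κ x y)) ∂μ := by
    filter_upwards [hTf.coeFn_toLp] with y hy
    rw [hy, RCLike.inner_apply, integral_const_mul, mul_comm]
  rw [adjoint_inner_right, L2.inner_def, L2.inner_def, integral_congr_ae hleft,
    integral_congr_ae hright]
  exact (integral_integral_swap (hint g)).symm

end IntegralOperator

section ReproducingSpace

variable {𝕜 H X : Type*} [RCLike 𝕜] [NormedAddCommGroup H] [InnerProductSpace 𝕜 H]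

/-- The linear map sending a vector `g` of a Hilbert space to its coefficients `⟪k z, g⟫` along
the family `k`. -/
def coefficientMap (𝕜 : Type*) [RCLike 𝕜] [InnerProductSpace 𝕜 H] (k : X → H) :
    H →ₗ[𝕜] (X → 𝕜) :=
  LinearMap.pi fun z => (innerSL 𝕜 (k z)).toLinearMap

theorem coefficientMap_apply (k : X → H) (g : H) (z : X) :
    coefficientMap 𝕜 k g z = inner 𝕜 (k z) g := rfl

variable [MeasurableSpace X]

/-- The Gram kernel of the total family `k` reproduces, through integration against `μ`, the
functions of the space `V` of square-integrable functions, and `V` contains every coefficient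
function of `k` that is square-integrable. -/
structure IsReproducingSpace (k : X → H) (μ : Measure X) (V : Submodule 𝕜 (X → 𝕜)) : Prop where
  memLp : ∀ F ∈ V, MemLp F 2 μ
  mem_of_memLp : ∀ g, MemLp (coefficientMap 𝕜 k g) 2 μ → coefficientMap 𝕜 k g ∈ V
  memLp_kernel : ∀ w, MemLp (coefficientMap 𝕜 k (k w)) 2 μ
  reproducing : ∀ F ∈ V, ∀ w, ∫ z, F z * conj (inner 𝕜 (k z) (k w)) ∂μ = F w
  dense_span : Dense (Submodule.span 𝕜 (Set.range k) : Set H)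

namespace IsReproducingSpace

variable {k : X → H} {μ : Measure X} {V : Submodule 𝕜 (X → 𝕜)} (h : IsReproducingSpace k μ V)

/-- The inclusion of a reproducing space into `L²`. -/
def toLp : V →ₗ[𝕜] Lp 𝕜 2 μ where
  toFun F := (h.memLp F F.2).toLp
  map_add' _ _ := rfl
  map_smul' _ _ := rfl

theorem coeFn_toLp (F : V) : h.toLp F =ᵐ[μ] (F : X → 𝕜) := (h.memLp F F.2).coeFn_toLp

include h in
theorem span_le_comap : Submodule.span 𝕜 (Set.range k) ≤ V.comap (coefficientMap 𝕜 k) :=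
  Submodule.span_le.2 (Set.range_subset_iff.2 fun w => h.mem_of_memLp _ (h.memLp_kernel w))

theorem inner_toLp_kernel (w : X) (F : V) :
    inner 𝕜 (h.toLp ⟨_, h.mem_of_memLp _ (h.memLp_kernel w)⟩) (h.toLp F) = (F : X → 𝕜) w := by
  rw [L2.inner_def, ← h.reproducing F F.2 w]
  refine integral_congr_ae ?_
  filter_upwards [h.coeFn_toLp F, h.coeFn_toLp ⟨_, h.mem_of_memLp _ (h.memLp_kernel w)⟩]
    with z hF hk
  rw [hk, hF, RCLike.inner_apply, coefficientMap_apply]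

theorem inner_toLp_coefficientMap {u g : H} (hu : u ∈ Submodule.span 𝕜 (Set.range k))
    (hg : coefficientMap 𝕜 k g ∈ V) :
    inner 𝕜 (h.toLp ⟨_, h.span_le_comap hu⟩) (h.toLp ⟨_, hg⟩) = inner 𝕜 u g := by
  let T := h.toLp ∘ₗ (coefficientMap 𝕜 k).restrict (p := V.comap (coefficientMap 𝕜 k))
    fun _ hu => hu
  change inner 𝕜 (T ⟨u, h.span_le_comap hu⟩) (T ⟨g, hg⟩) = _
  induction hu using Submodule.span_induction with
  | mem x hx =>
    obtain ⟨w, rfl⟩ := hx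
    exact h.inner_toLp_kernel w ⟨_, hg⟩
  | zero => exact (congrArg (inner 𝕜 · _) (map_zero T)).trans (by simp only [inner_zero_left])
  | add u v hu hv ihu ihv =>
    rw [inner_add_left, ← ihu, ← ihv, ← inner_add_left, ← map_add]
    rfl
  | smul c u hu ihu =>
    rw [inner_smul_left, ← ihu, ← inner_smul_left, ← map_smul]
    rfl

theorem norm_toLp_coefficientMap {u : H} (hu : u ∈ Submodule.span 𝕜 (Set.range k)) :
    ‖h.toLp ⟨_, h.span_le_comap hu⟩‖ = ‖u‖ := by
  rw [@norm_eq_sqrt_re_inner 𝕜, h.inner_toLp_coefficientMap hu, ← @norm_eq_sqrt_re_inner 𝕜]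

include h in
theorem eLpNorm_coefficientMap_of_mem_span {u : H} (hu : u ∈ Submodule.span 𝕜 (Set.range k)) :
    eLpNorm (coefficientMap 𝕜 k u) 2 μ = ‖u‖ₑ := by
  rw [← eLpNorm_congr_ae (h.coeFn_toLp ⟨_, h.span_le_comap hu⟩), ← Lp.enorm_def, ← ofReal_norm,
    h.norm_toLp_coefficientMap hu, ofReal_norm]

include h in
theorem memLp_and_eLpNorm_coefficientMap_le (g : H) :
    MemLp (coefficientMap 𝕜 k g) 2 μ ∧ eLpNorm (coefficientMap 𝕜 k g) 2 μ ≤ ‖g‖ₑ := by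
  obtain ⟨u, hu, hlim⟩ := mem_closure_iff_seq_limit.1 (h.dense_span g)
  have hmeas n := (h.memLp _ (h.span_le_comap (hu n))).1
  have hpoint (z : X) :
      Tendsto (fun n => coefficientMap 𝕜 k (u n) z) atTop (𝓝 (coefficientMap 𝕜 k g z)) :=
    tendsto_const_nhds.inner hlim
  have hle : eLpNorm (coefficientMap 𝕜 k g) 2 μ ≤ ‖g‖ₑ :=
    (Lp.eLpNorm_lim_le_liminf_eLpNorm hmeas _ (ae_of_all _ hpoint)).trans_eq <| by
      simp only [h.eLpNorm_coefficientMap_of_mem_span (hu _), hlim.enorm.liminf_eq]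
  exact ⟨⟨aestronglyMeasurable_of_tendsto_ae atTop hmeas (ae_of_all _ hpoint),
    hle.trans_lt enorm_lt_top⟩, hle⟩

include h in
theorem coefficientMap_mem (g : H) : coefficientMap 𝕜 k g ∈ V :=
  h.mem_of_memLp g (h.memLp_and_eLpNorm_coefficientMap_le g).1

/-- The map `g ↦ ⟪k ·, g⟫` as a bounded operator into `L²`. -/
def toLpCLM : H →L[𝕜] Lp 𝕜 2 μ :=
  (h.toLp ∘ₗ (coefficientMap 𝕜 k).codRestrict V h.coefficientMap_mem).mkContinuous 1 fun g => by
    rw [one_mul, ← enorm_le_iff_norm_le, Lp.enorm_def]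
    exact (eLpNorm_congr_ae (h.coeFn_toLp ⟨_, h.coefficientMap_mem g⟩)).trans_le
      (h.memLp_and_eLpNorm_coefficientMap_le g).2

theorem coeFn_toLpCLM (g : H) : h.toLpCLM g =ᵐ[μ] coefficientMap 𝕜 k g :=
  h.coeFn_toLp ⟨_, h.coefficientMap_mem g⟩

theorem norm_toLpCLM (g : H) : ‖h.toLpCLM g‖ = ‖g‖ :=
  congr_fun (Continuous.ext_on h.dense_span h.toLpCLM.continuous.norm continuous_norm
    fun _ hu => h.norm_toLp_coefficientMap hu) g

variable [CompleteSpace H]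

open ContinuousLinearMap in
theorem coefficientMap_adjoint_toLp (F : V) :
    coefficientMap 𝕜 k (adjoint h.toLpCLM (h.toLp F)) = F := by
  ext w
  rw [coefficientMap_apply, adjoint_inner_right]
  exact h.inner_toLp_kernel w F

/-- The isomorphism `g ↦ ⟪k ·, g⟫` from the Hilbert space onto the reproducing space. -/
def equiv : H ≃ₗ[𝕜] V where
  __ := (coefficientMap 𝕜 k).codRestrict V h.coefficientMap_mem
  invFun F := ContinuousLinearMap.adjoint h.toLpCLM (h.toLp F)
  left_inv := DFunLike.congr_fun
    ((ContinuousLinearMap.norm_map_iff_adjoint_comp_self _).1 h.norm_toLpCLM)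
  right_inv F := Subtype.ext (h.coefficientMap_adjoint_toLp F)

theorem equiv_apply (g : H) (z : X) : (h.equiv g : X → 𝕜) z = inner 𝕜 (k z) g := rfl

theorem equiv_symm_apply (F : V) :
    h.equiv.symm F = ContinuousLinearMap.adjoint h.toLpCLM (h.toLp F) := rfl

end IsReproducingSpace

end ReproducingSpace

section WeightedMeanValue

variable {E : Type*} [NormedAddCommGroup E]

theorem integrableOn_polarCoord_target_iff [NormedSpace ℝ E] {f : ℂ → E} :
    IntegrableOn (fun p : ℝ × ℝ => p.1 • f (Complex.polarCoord.symm p)) polarCoord.target ↔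
      Integrable f := by
  have hreal (g : ℝ × ℝ → E) : IntegrableOn (fun p => p.1 • g (polarCoord.symm p))
      polarCoord.target ↔ Integrable g := by
    rw [← integrableOn_univ (f := g), ← integrableOn_congr_set_ae polarCoord_source_ae_eq_univ,
      ← polarCoord.symm_image_target_eq_source,
      integrableOn_image_iff_integrableOn_abs_det_fderiv_smul volume
        polarCoord.open_target.measurableSet
        (fun p _ => (hasFDerivAt_polarCoord_symm p).hasFDerivWithinAt) polarCoord.symm.injOn]
    refine integrableOn_congr_fun (fun p hp => ?_) polarCoord.open_target.measurableSet
    rw [det_fderivPolarCoordSymm, abs_of_pos hp.1]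
  rw [← Complex.volume_preserving_equiv_real_prod.symm.integrable_comp_emb
    Complex.measurableEquivRealProd.symm.measurableEmbedding, ← hreal]
  rfl

variable [NormedSpace ℂ E]

theorem integral_polarCoord_symm_eq_smul_circleAverage (f : ℂ → E) (r : ℝ) :
    ∫ θ in Set.Ioo (-Real.pi) Real.pi, f (Complex.polarCoord.symm (r, θ)) =
      (2 * Real.pi) • Real.circleAverage f 0 r := by
  have hcircle (θ : ℝ) :
      Complex.polarCoord.symm (r, θ + -Real.pi) = circleMap 0 r (θ + -Real.pi) := by
    rw [Complex.polarCoord_symm_apply, circleMap, zero_add, Complex.exp_mul_I,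
      Complex.ofReal_cos, Complex.ofReal_sin]
  rw [Real.circleAverage_eq_integral_add (-Real.pi), smul_inv_smul₀ Real.two_pi_pos.ne']
  simp only [← hcircle]
  rw [intervalIntegral.integral_comp_add_right (fun θ => f (Complex.polarCoord.symm (r, θ))),
    zero_add, two_mul, add_neg_cancel_right, intervalIntegral.integral_of_le
    (by linarith [Real.pi_pos]), integral_Ioc_eq_integral_Ioo]

theorem integral_ball_norm_smul [CompleteSpace E] {R : ℝ} {ρ : ℝ → ℝ} {G : ℂ → E}
    (hG : DifferentiableOn ℂ G (Metric.ball 0 R))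
    (hi : IntegrableOn (fun ζ => ρ ‖ζ‖ • G ζ) (Metric.ball 0 R)) :
    ∫ ζ in Metric.ball (0 : ℂ) R, ρ ‖ζ‖ • G ζ =
      (2 * Real.pi * ∫ r in Set.Ioo 0 R, r * ρ r) • G 0 := by
  set f := (Metric.ball (0 : ℂ) R).indicator fun ζ => ρ ‖ζ‖ • G ζ with hf
  have hpolar := integrableOn_polarCoord_target_iff.2 (hi.integrable_indicator measurableSet_ball)
  have hinner {r : ℝ} (hr : r ∈ Set.Ioi 0) :
      ∫ θ in Set.Ioo (-Real.pi) Real.pi, r • f (Complex.polarCoord.symm (r, θ)) =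
        (Set.Ioo 0 R).indicator (fun r => (r * ρ r) • (2 * Real.pi) • G 0) r := by
    have hnorm (θ : ℝ) : ‖Complex.polarCoord.symm (r, θ)‖ = r := by
      rw [Complex.norm_polarCoord_symm, abs_of_pos hr]
    by_cases hR : r < R
    · have hcl : DiffContOnCl ℂ G (Metric.ball 0 |r|) := (hG.mono (by
        rw [abs_of_pos hr]
        exact Metric.closure_ball_subset_closedBall.trans
          (Metric.closedBall_subset_ball hR))).diffContOnCl
      rw [Set.indicator_of_mem (Set.mem_Ioo.2 ⟨hr, hR⟩), ← hcl.circleAverage,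
        ← integral_polarCoord_symm_eq_smul_circleAverage, ← integral_smul]
      congr 1 with θ
      rw [hf, Set.indicator_of_mem (by rwa [mem_ball_zero_iff, hnorm]), hnorm, smul_smul]
    · rw [Set.indicator_of_notMem fun h => hR h.2]
      refine integral_eq_zero_of_ae (ae_of_all _ fun θ => ?_)
      change r • f _ = 0
      rw [hf, Set.indicator_of_notMem (by rwa [mem_ball_zero_iff, hnorm]), smul_zero]
  rw [polarCoord_target, Measure.volume_eq_prod] at hpolar
  rw [← integral_indicator measurableSet_ball, ← Complex.integral_comp_polarCoord_symm,
    polarCoord_target, Measure.volume_eq_prod, setIntegral_prod _ hpolar,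
    setIntegral_congr_fun measurableSet_Ioi fun r hr => hinner hr,
    setIntegral_indicator measurableSet_Ioo, Set.inter_eq_right.2 fun r hr => hr.1,
    integral_smul_const, smul_smul, mul_comm]

theorem integral_mul_one_sub_sq_pow (n : ℕ) :
    ∫ r in Set.Ioo (0 : ℝ) 1, r * (1 - r ^ 2) ^ n = (2 * ((n : ℝ) + 1))⁻¹ := by
  have hderiv (r : ℝ) : HasDerivAt
      (fun r : ℝ => -((2 * ((n : ℝ) + 1))⁻¹ * (1 - r ^ 2) ^ (n + 1))) (r * (1 - r ^ 2) ^ n) r := by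
    refine (((((hasDerivAt_pow 2 r).const_sub 1).pow (n + 1)).const_mul _).neg).congr_deriv ?_
    rw [Nat.add_sub_cancel]
    push_cast
    field_simp
  rw [← integral_Ioc_eq_integral_Ioo, ← intervalIntegral.integral_of_le zero_le_one,
    intervalIntegral.integral_eq_sub_of_hasDerivAt (fun r _ => hderiv r)
      (Continuous.intervalIntegrable (by fun_prop) _ _)]
  simp

end WeightedMeanValue

section HolomorphicChangeOfVariables

theorem det_restrictScalars_toSpanSingleton (c : ℂ) :
    ((ContinuousLinearMap.toSpanSingleton ℂ c).restrictScalars ℝ).det = ‖c‖ ^ 2 := by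
  have hdet := LinearMap.det_restrictScalars (R := ℝ) (f := LinearMap.toSpanSingleton ℂ ℂ c)
  rw [LinearMap.det_ring, LinearMap.toSpanSingleton_apply, one_smul,
    Algebra.norm_complex_eq] at hdet
  exact hdet.trans (Complex.normSq_eq_norm_sq c)

variable {E : Type*} [NormedAddCommGroup E] [NormedSpace ℝ E] {f f' : ℂ → ℂ} {s : Set ℂ}

theorem integrableOn_image_iff_integrableOn_norm_deriv_sq_smul (hs : MeasurableSet s)
    (hf' : ∀ z ∈ s, HasDerivAt f (f' z) z) (hf : Set.InjOn f s) (g : ℂ → E) :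
    IntegrableOn g (f '' s) ↔ IntegrableOn (fun z => ‖f' z‖ ^ 2 • g (f z)) s := by
  simpa only [det_restrictScalars_toSpanSingleton, abs_pow, abs_norm] using
    integrableOn_image_iff_integrableOn_abs_det_fderiv_smul volume hs
      (fun z hz => ((hf' z hz).hasFDerivAt.restrictScalars ℝ).hasFDerivWithinAt) hf g

theorem integral_image_eq_integral_norm_deriv_sq_smul (hs : MeasurableSet s)
    (hf' : ∀ z ∈ s, HasDerivAt f (f' z) z) (hf : Set.InjOn f s) (g : ℂ → E) :
    ∫ z in f '' s, g z = ∫ z in s, ‖f' z‖ ^ 2 • g (f z) := by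
  simpa only [det_restrictScalars_toSpanSingleton, abs_pow, abs_norm] using
    integral_image_eq_integral_abs_det_fderiv_smul volume hs
      (fun z hz => ((hf' z hz).hasFDerivAt.restrictScalars ℝ).hasFDerivWithinAt) hf g

end HolomorphicChangeOfVariables

section CayleyTransform

/-- The Cayley transform from the unit disk onto the right half plane that maps `0` to `w`. -/
def cayley (w ζ : ℂ) : ℂ := (w + conj w * ζ) / (1 - ζ)

variable {w ζ : ℂ}

theorem cayley_zero : cayley w 0 = w := by simp [cayley]

theorem ne_one_of_mem_ball (hζ : ζ ∈ Metric.ball 0 1) : ζ ≠ 1 := by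
  rintro rfl
  simp at hζ

theorem cayley_add_conj (hζ : ζ ≠ 1) : cayley w ζ + conj w = 2 * w.re / (1 - ζ) := by
  have := sub_ne_zero.2 hζ.symm
  have hre : (2 * w.re : ℂ) = w + conj w := by rw [Complex.add_conj, Complex.ofReal_mul]; rfl
  rw [cayley, hre]
  field_simp
  ring

theorem re_cayley (hζ : ζ ≠ 1) : (cayley w ζ).re = w.re * (1 - ‖ζ‖ ^ 2) / ‖1 - ζ‖ ^ 2 := by
  have hne := Complex.normSq_pos.2 (sub_ne_zero.2 hζ.symm)
  rw [cayley, Complex.div_re, ← Complex.normSq_eq_norm_sq, ← Complex.normSq_eq_norm_sq]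
  field_simp
  simp only [Complex.normSq_apply, Complex.add_re, Complex.mul_re, Complex.conj_re,
    Complex.conj_im, Complex.sub_re, Complex.one_re, Complex.add_im, Complex.mul_im,
    Complex.sub_im, Complex.one_im]
  ring

theorem hasDerivAt_cayley (hζ : ζ ≠ 1) :
    HasDerivAt (cayley w) (2 * w.re / (1 - ζ) ^ 2) ζ := by
  have hre : (2 * w.re : ℂ) = w + conj w := by rw [Complex.add_conj, Complex.ofReal_mul]; rfl
  refine ((((hasDerivAt_id ζ).const_mul (conj w)).const_add w).div
    ((hasDerivAt_id ζ).const_sub 1) (sub_ne_zero.2 hζ.symm)).congr_deriv ?_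
  rw [hre, id]
  ring

theorem norm_sub_lt_norm_add_conj {z : ℂ} (hz : 0 < z.re) (hw : 0 < w.re) :
    ‖z - w‖ < ‖z + conj w‖ := by
  rw [← sq_lt_sq₀ (norm_nonneg _) (norm_nonneg _), ← Complex.normSq_eq_norm_sq,
    ← Complex.normSq_eq_norm_sq, Complex.normSq_sub, Complex.normSq_add, Complex.normSq_conj,
    Complex.conj_conj, Complex.mul_re, Complex.mul_re, Complex.conj_re, Complex.conj_im]
  nlinarith [mul_pos hz hw]

theorem cayley_injOn (hw : 0 < w.re) : Set.InjOn (cayley w) {ζ | ζ ≠ 1} := by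
  intro ζ hζ η hη heq
  have hw' : (2 * w.re : ℂ) ≠ 0 := by exact_mod_cast (mul_pos two_pos hw).ne'
  have hquot := cayley_add_conj (w := w) hζ
  rw [heq, cayley_add_conj hη, div_eq_mul_inv, div_eq_mul_inv, mul_right_inj' hw', inv_inj,
    sub_right_inj] at hquot
  exact hquot.symm

theorem cayley_image_ball (hw : 0 < w.re) :
    cayley w '' Metric.ball 0 1 = {z : ℂ | 0 < z.re} := by
  refine Set.Subset.antisymm ?_ fun z hz => ?_
  · rintro _ ⟨ζ, hζ, rfl⟩
    have hne := sub_ne_zero.2 (ne_one_of_mem_ball hζ).symm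
    rw [Set.mem_ofPred_eq, re_cayley (ne_one_of_mem_ball hζ)]
    have : 0 < 1 - ‖ζ‖ ^ 2 :=
      sub_pos.2 (pow_lt_one₀ (norm_nonneg ζ) (mem_ball_zero_iff.1 hζ) two_ne_zero)
    positivity
  · have hlt := norm_sub_lt_norm_add_conj hz hw
    have hpos : 0 < ‖z + conj w‖ := (norm_nonneg _).trans_lt hlt
    have hne : z + conj w ≠ 0 := norm_pos_iff.1 hpos
    have hre : w + conj w ≠ 0 := by
      rw [Complex.add_conj]
      exact_mod_cast (mul_pos two_pos hw).ne'
    refine ⟨(z - w) / (z + conj w), ?_, ?_⟩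
    · rwa [mem_ball_zero_iff, norm_div, div_lt_one hpos]
    · have hsub : 1 - (z - w) / (z + conj w) = (w + conj w) / (z + conj w) := by
        field_simp
        ring
      rw [cayley, hsub]
      field_simp
      ring

theorem differentiableOn_cayley : DifferentiableOn ℂ (cayley w) (Metric.ball 0 1) := fun _ hζ =>
  (hasDerivAt_cayley (ne_one_of_mem_ball hζ)).differentiableAt.differentiableWithinAt

/-- The kernel `(Re z)ⁿ` times the conjugate of `(z + w̄)^{-(n+2)}`: up to a constant, its integral
against a holomorphic function on the right half plane is the value of that function at `w`. -/
def weightedKernel (n : ℕ) (w z : ℂ) : ℂ := (z.re ^ n : ℝ) * conj (1 / (z + conj w) ^ (n + 2))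

theorem jacobian_mul_weightedKernel (hw : 0 < w.re) (hζ : ζ ≠ 1) (n : ℕ) :
    ((‖2 * w.re / (1 - ζ) ^ 2‖ ^ 2 : ℝ) : ℂ) * weightedKernel n w (cayley w ζ) =
      (((1 - ‖ζ‖ ^ 2) / 2) ^ n : ℝ) * (1 / (1 - ζ) ^ (n + 2)) := by
  have hw' : (w.re : ℂ) ≠ 0 := by exact_mod_cast hw.ne'
  have hne : 1 - ζ ≠ 0 := sub_ne_zero.2 hζ.symm
  have hconj : 1 - conj ζ ≠ 0 := fun h => hne (by simpa using congrArg conj h)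
  have hnorm : (‖1 - ζ‖ : ℂ) ^ 2 = (1 - ζ) * (1 - conj ζ) := by
    rw [← Complex.mul_conj', map_sub, map_one]
  have hjac : ((‖2 * w.re / (1 - ζ) ^ 2‖ ^ 2 : ℝ) : ℂ) =
      (2 * w.re) ^ 2 / ((1 - ζ) * (1 - conj ζ)) ^ 2 := by
    rw [← hnorm, norm_div, norm_mul, norm_pow, Complex.norm_ofNat, Complex.norm_real,
      Real.norm_of_nonneg hw.le]
    push_cast
    ring
  have hre : (((cayley w ζ).re ^ n : ℝ) : ℂ) =
      (w.re * (1 - ‖ζ‖ ^ 2)) ^ n / ((1 - ζ) * (1 - conj ζ)) ^ n := by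
    rw [← hnorm, re_cayley hζ]
    push_cast
    rw [div_pow]
  rw [weightedKernel, hjac, hre, cayley_add_conj hζ]
  simp only [map_div₀, map_one, map_mul, map_pow, map_sub, Complex.conj_ofReal, map_ofNat]
  push_cast
  simp only [div_pow, mul_pow]
  generalize 1 - conj ζ = b at *
  generalize 1 - ζ = a at *
  field_simp
  ring

end CayleyTransform

section HalfPlaneReproducingFormula

variable {w : ℂ}

theorem integrableOn_halfPlane_iff {E : Type*} [NormedAddCommGroup E] [NormedSpace ℝ E]
    (hw : 0 < w.re) (f : ℂ → E) :
    IntegrableOn f {z : ℂ | 0 < z.re} ↔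
      IntegrableOn (fun ζ : ℂ => ‖2 * w.re / (1 - ζ) ^ 2‖ ^ 2 • f (cayley w ζ))
        (Metric.ball 0 1) := by
  rw [← cayley_image_ball hw]
  exact integrableOn_image_iff_integrableOn_norm_deriv_sq_smul measurableSet_ball
    (fun ζ hζ => hasDerivAt_cayley (ne_one_of_mem_ball hζ))
    ((cayley_injOn hw).mono fun ζ => ne_one_of_mem_ball) f

theorem integral_halfPlane_eq_integral_ball {E : Type*} [NormedAddCommGroup E] [NormedSpace ℝ E]
    (hw : 0 < w.re) (f : ℂ → E) :
    ∫ z in {z : ℂ | 0 < z.re}, f z =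
      ∫ ζ in Metric.ball (0 : ℂ) 1, ‖2 * w.re / (1 - ζ) ^ 2‖ ^ 2 • f (cayley w ζ) := by
  rw [← cayley_image_ball hw]
  exact integral_image_eq_integral_norm_deriv_sq_smul measurableSet_ball
    (fun ζ hζ => hasDerivAt_cayley (ne_one_of_mem_ball hζ))
    ((cayley_injOn hw).mono fun ζ => ne_one_of_mem_ball) f

variable {E : Type*} [NormedAddCommGroup E] [NormedSpace ℂ E]

theorem jacobian_smul_weightedKernel_smul {ζ : ℂ} (hw : 0 < w.re) (hζ : ζ ≠ 1) (n : ℕ) (v : E) :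
    ‖2 * w.re / (1 - ζ) ^ 2‖ ^ 2 • weightedKernel n w (cayley w ζ) • v =
      ((1 - ‖ζ‖ ^ 2) / 2) ^ n • (1 / (1 - ζ) ^ (n + 2)) • v := by
  rw [← Complex.coe_smul, ← Complex.coe_smul, smul_smul, smul_smul,
    jacobian_mul_weightedKernel hw hζ]

theorem integral_weightedKernel_smul [CompleteSpace E] (hw : 0 < w.re) (n : ℕ) {F : ℂ → E}
    (hF : DifferentiableOn ℂ F {z | 0 < z.re})
    (hi : IntegrableOn (fun z => weightedKernel n w z • F z) {z | 0 < z.re}) :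
    ∫ z in {z : ℂ | 0 < z.re}, weightedKernel n w z • F z =
      (Real.pi / (2 ^ n * (n + 1))) • F w := by
  have hpull : Set.EqOn
      (fun ζ : ℂ => ‖2 * w.re / (1 - ζ) ^ 2‖ ^ 2 •
        weightedKernel n w (cayley w ζ) • F (cayley w ζ))
      (fun ζ => ((1 - ‖ζ‖ ^ 2) / 2) ^ n • (1 / (1 - ζ) ^ (n + 2)) • F (cayley w ζ))
      (Metric.ball 0 1) :=
    fun ζ hζ => jacobian_smul_weightedKernel_smul hw (ne_one_of_mem_ball hζ) n _
  have hholo : DifferentiableOn ℂ (fun ζ => (1 / (1 - ζ) ^ (n + 2)) • F (cayley w ζ))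
      (Metric.ball 0 1) := by
    refine DifferentiableOn.smul ?_ (hF.comp differentiableOn_cayley ?_)
    · exact (differentiableOn_const 1).div (by fun_prop) fun ζ hζ =>
        pow_ne_zero _ (sub_ne_zero.2 (ne_one_of_mem_ball hζ).symm)
    · exact cayley_image_ball hw ▸ Set.mapsTo_image _ _
  rw [integrableOn_halfPlane_iff hw, integrableOn_congr_fun hpull measurableSet_ball] at hi
  rw [integral_halfPlane_eq_integral_ball hw, setIntegral_congr_fun measurableSet_ball hpull,
    integral_ball_norm_smul (ρ := fun r => ((1 - r ^ 2) / 2) ^ n) hholo hi]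
  simp only [div_pow, ← mul_div_assoc, integral_div, integral_mul_one_sub_sq_pow, cayley_zero,
    sub_zero, one_pow, div_one, one_smul]
  congr 1
  field_simp

theorem integrableOn_weightedKernel_mul (hw : 0 < w.re) (n : ℕ) :
    IntegrableOn (fun z => weightedKernel n w z * (1 / (z + conj w) ^ (n + 2)))
      {z | 0 < z.re} := by
  rw [integrableOn_halfPlane_iff hw]
  have hpull : Set.EqOn
      (fun ζ : ℂ => ‖2 * w.re / (1 - ζ) ^ 2‖ ^ 2 •
        (weightedKernel n w (cayley w ζ) * (1 / (cayley w ζ + conj w) ^ (n + 2))))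
      (fun ζ => (((1 - ‖ζ‖ ^ 2) / 2) ^ n : ℝ) * (1 / (2 * w.re) ^ (n + 2)))
      (Metric.ball 0 1) := fun ζ hζ => by
    have hne := sub_ne_zero.2 (ne_one_of_mem_ball hζ).symm
    refine (jacobian_smul_weightedKernel_smul hw (ne_one_of_mem_ball hζ) n _).trans ?_
    rw [cayley_add_conj (ne_one_of_mem_ball hζ), Complex.real_smul, smul_eq_mul,
      div_pow (2 * (w.re : ℂ))]
    field_simp
  rw [integrableOn_congr_fun hpull measurableSet_ball]
  refine (Continuous.continuousOn ?_).integrableOn_compact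
    (isCompact_closedBall (0 : ℂ) 1) |>.mono_set Metric.ball_subset_closedBall
  fun_prop

end HalfPlaneReproducingFormula

section HalfPlaneMeasures

theorem RightHalfPlane.ne_zero (z : RightHalfPlane) : (z : ℂ) ≠ 0 := fun h =>
  z.2.ne' (by rw [h, Complex.zero_re])

theorem RightHalfPlane.add_conj_ne_zero (z w : RightHalfPlane) : (z : ℂ) + conj (w : ℂ) ≠ 0 :=
  norm_pos_iff.1 ((norm_nonneg _).trans_lt (norm_sub_lt_norm_add_conj z.2 w.2))

theorem integrable_areaMeasure_iff {E : Type*} [NormedAddCommGroup E] (f : ℂ → E) :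
    Integrable (fun z : RightHalfPlane => f z) areaMeasure ↔ IntegrableOn f {z : ℂ | 0 < z.re} :=
  (integrableOn_iff_comap_subtypeVal (Complex.isOpen_re_gt 0).measurableSet).symm

theorem integral_areaMeasure {E : Type*} [NormedAddCommGroup E] [NormedSpace ℝ E] (f : ℂ → E) :
    ∫ z : RightHalfPlane, f z ∂areaMeasure = ∫ z in {z : ℂ | 0 < z.re}, f z :=
  integral_subtype_comap (Complex.isOpen_re_gt 0).measurableSet f

instance : IsFiniteMeasureOnCompacts areaMeasure :=
  .comap' _ continuous_subtype_val
    (MeasurableEmbedding.subtype_coe (Complex.isOpen_re_gt 0).measurableSet)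

instance : LocallyCompactSpace RightHalfPlane := (Complex.isOpen_re_gt 0).locallyCompactSpace

/-- The density of `inversionMeasure t` with respect to `areaMeasure`. -/
def inversionDensity (t : ℝ) (z : RightHalfPlane) : ℝ :=
  2 * Real.pi⁻¹ * (‖(z : ℂ)‖ ^ 2)⁻¹ * Real.exp (2 / t * (z : ℂ).re) * (z : ℂ).re

theorem inversionDensity_nonneg (t : ℝ) (z : RightHalfPlane) : 0 ≤ inversionDensity t z := by
  have := z.2
  unfold inversionDensity
  positivity

theorem continuous_inversionDensity (t : ℝ) : Continuous (inversionDensity t) := by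
  have hinv : Continuous fun z : RightHalfPlane => (‖(z : ℂ)‖ ^ 2)⁻¹ :=
    Continuous.inv₀ (by fun_prop) fun z => pow_ne_zero 2 (norm_ne_zero_iff.2 z.ne_zero)
  unfold inversionDensity
  fun_prop

instance (t : ℝ) : IsLocallyFiniteMeasure (inversionMeasure t) :=
  .withDensity_ofReal (continuous_inversionDensity t)

variable {E : Type*} [NormedAddCommGroup E] [NormedSpace ℝ E] (t : ℝ) (f : RightHalfPlane → E)

theorem integrable_inversionMeasure_iff :
    Integrable f (inversionMeasure t) ↔
      Integrable (fun z => inversionDensity t z • f z) areaMeasure := by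
  refine (integrable_withDensity_iff_integrable_smul'
    (continuous_inversionDensity t).measurable.ennreal_ofReal (by simp)).trans ?_
  simp only [ENNReal.toReal_ofReal (inversionDensity_nonneg t _)]

theorem integral_inversionMeasure :
    ∫ z, f z ∂inversionMeasure t = ∫ z, inversionDensity t z • f z ∂areaMeasure := by
  refine (integral_withDensity_eq_integral_toReal_smul
    (continuous_inversionDensity t).measurable.ennreal_ofReal (by simp) f).trans ?_
  simp only [ENNReal.toReal_ofReal (inversionDensity_nonneg t _)]

end HalfPlaneMeasures

section RangeSpace

theorem IsHolomorphic.mul {f g : RightHalfPlane → ℂ} (hf : IsHolomorphic f)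
    (hg : IsHolomorphic g) : IsHolomorphic fun z => f z * g z := by
  obtain ⟨F, hF, hfF⟩ := hf
  obtain ⟨G, hG, hgG⟩ := hg
  exact ⟨fun z => F z * G z, hF.mul hG, fun z => congrArg₂ _ (hfF z) (hgG z)⟩

theorem IsHolomorphic.inv {f : RightHalfPlane → ℂ} (hf : IsHolomorphic f) (h0 : ∀ z, f z ≠ 0) :
    IsHolomorphic fun z => (f z)⁻¹ := by
  obtain ⟨F, hF, hfF⟩ := hf
  exact ⟨fun z => (F z)⁻¹, hF.fun_inv fun z hz => hfF ⟨z, hz⟩ ▸ h0 _, fun z => congrArg _ (hfF z)⟩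

/-- The factor `z e^{-z/t}` that carries the weighted Bergman space onto the range space. -/
def rangeFactor (t : ℝ) (z : RightHalfPlane) : ℂ := (z : ℂ) * Complex.exp (-(z : ℂ) / t)

variable {t : ℝ}

theorem rangeFactor_ne_zero (z : RightHalfPlane) : rangeFactor t z ≠ 0 :=
  mul_ne_zero z.ne_zero (Complex.exp_ne_zero _)

theorem inv_rangeFactor (z : RightHalfPlane) :
    (rangeFactor t z)⁻¹ = (z : ℂ)⁻¹ * Complex.exp ((z : ℂ) / t) := by
  rw [rangeFactor, mul_inv, ← Complex.exp_neg, neg_div, neg_neg]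

theorem isHolomorphic_rangeFactor : IsHolomorphic (rangeFactor t) :=
  ⟨fun z => z * Complex.exp (-z / t), by fun_prop, fun _ => rfl⟩

theorem inversionDensity_mul_norm_sq_rangeFactor (z : RightHalfPlane) :
    inversionDensity t z * ‖rangeFactor t z‖ ^ 2 = 2 / Real.pi * (z : ℂ).re := by
  have hne := norm_ne_zero_iff.2 z.ne_zero
  have hexp : Real.exp (2 / t * (z : ℂ).re) * Real.exp (-(z : ℂ).re / t) ^ 2 = 1 := by
    rw [← Real.exp_nat_mul, ← Real.exp_add, ← Real.exp_zero]
    push_cast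
    ring_nf
  calc inversionDensity t z * ‖rangeFactor t z‖ ^ 2
      = 2 / Real.pi * (z : ℂ).re * ((‖(z : ℂ)‖ ^ 2)⁻¹ * ‖(z : ℂ)‖ ^ 2) *
          (Real.exp (2 / t * (z : ℂ).re) * Real.exp (-(z : ℂ).re / t) ^ 2) := by
        rw [inversionDensity, rangeFactor, norm_mul, Complex.norm_exp, Complex.div_ofReal_re,
          Complex.neg_re]
        ring
    _ = 2 / Real.pi * (z : ℂ).re := by
        rw [hexp, inv_mul_cancel₀ (pow_ne_zero 2 hne), mul_one, mul_one]

theorem inversionDensity_smul_norm_sq (f : RightHalfPlane → ℂ) (z : RightHalfPlane) :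
    inversionDensity t z • ‖rangeFactor t z * f z‖ ^ 2 =
      2 / Real.pi * (‖f z‖ ^ 2 * (z : ℂ).re) := by
  rw [smul_eq_mul, norm_mul, mul_pow, ← mul_assoc, inversionDensity_mul_norm_sq_rangeFactor]
  ring

theorem mem_rangeSpace_iff_exists {F : RightHalfPlane → ℂ} :
    F ∈ rangeSpace t ↔ ∃ f ∈ weightedBergman, (fun z => rangeFactor t z * f z) = F := Iff.rfl

theorem memLp_rangeFactor_mul_iff {f : RightHalfPlane → ℂ} (hf : IsHolomorphic f) :
    MemLp (fun z => rangeFactor t z * f z) 2 (inversionMeasure t) ↔ f ∈ weightedBergman := by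
  rw [memLp_two_iff_integrable_sq_norm
    (isHolomorphic_rangeFactor.mul hf).continuous.aestronglyMeasurable,
    integrable_inversionMeasure_iff]
  simp only [inversionDensity_smul_norm_sq]
  rw [integrable_const_mul_iff (isUnit_iff_ne_zero.2 (div_ne_zero two_ne_zero Real.pi_ne_zero))]
  exact (and_iff_right hf).symm

theorem mem_rangeSpace_iff {F : RightHalfPlane → ℂ} :
    F ∈ rangeSpace t ↔ IsHolomorphic F ∧ MemLp F 2 (inversionMeasure t) := by
  refine ⟨?_, fun ⟨hF, hF2⟩ => ?_⟩
  · rintro ⟨f, hf, rfl⟩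
    exact ⟨isHolomorphic_rangeFactor.mul hf.1, (memLp_rangeFactor_mul_iff hf.1).2 hf⟩
  · have hdiv : (fun z => rangeFactor t z * ((rangeFactor t z)⁻¹ * F z)) = F :=
      funext fun z => mul_inv_cancel_left₀ (rangeFactor_ne_zero z) _
    refine mem_rangeSpace_iff_exists.2 ⟨_, (memLp_rangeFactor_mul_iff (t := t) ?_).1 ?_, hdiv⟩
    · exact (isHolomorphic_rangeFactor.inv rangeFactor_ne_zero).mul hF
    · rwa [hdiv]

theorem rangeNorm_eq_lpNorm {F : RightHalfPlane → ℂ} (hF : IsHolomorphic F) :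
    rangeNorm t F = lpNorm F 2 (inversionMeasure t) := by
  have hpi := Real.pi_pos
  have hint : ∫ z, ‖F z‖ ^ 2 ∂inversionMeasure t = 2 / Real.pi * ∫ z : RightHalfPlane,
      ‖(z : ℂ)⁻¹ * Complex.exp ((z : ℂ) / t) * F z‖ ^ 2 * (z : ℂ).re ∂areaMeasure := by
    rw [integral_inversionMeasure, ← integral_const_mul]
    congr 1 with z
    rw [← inv_rangeFactor, ← inversionDensity_smul_norm_sq fun z => (rangeFactor t z)⁻¹ * F z,
      mul_inv_cancel_left₀ (rangeFactor_ne_zero z)]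
  have hpow : Real.pi ^ (-(3 / 4) : ℝ) = Real.sqrt (Real.pi ^ (-(3 / 2) : ℝ)) := by
    rw [Real.sqrt_eq_rpow, ← Real.rpow_mul hpi.le]
    norm_num
  have hconst : Real.pi ^ (-(3 / 2) : ℝ) * (2 * Real.sqrt Real.pi) = 2 / Real.pi := by
    rw [Real.sqrt_eq_rpow, mul_left_comm, ← Real.rpow_add hpi,
      show (-(3 / 2) : ℝ) + 1 / 2 = -1 by norm_num, Real.rpow_neg_one, div_eq_mul_inv]
  rw [rangeNorm, bergmanNorm, hpow, ← Real.sqrt_mul (by positivity), ← mul_assoc, hconst, ← hint,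
    lpNorm_eq_integral_norm_rpow_toReal two_ne_zero ENNReal.ofNat_ne_top
    hF.continuous.aestronglyMeasurable, Real.sqrt_eq_rpow]
  simp

end RangeSpace

section RangeKernel

variable {t : ℝ}

/-- The reproducing kernel of the range space. -/
def rangeKernel (t : ℝ) (z w : RightHalfPlane) : ℂ :=
  rangeFactor t z * conj (rangeFactor t w) * (2 / ((z : ℂ) + conj (w : ℂ)) ^ 3)

theorem memLp_rangeKernel (w : RightHalfPlane) :
    MemLp (fun z => rangeKernel t z w) 2 (inversionMeasure t) := by
  have hholo : IsHolomorphic fun z => 1 / ((z : ℂ) + conj (w : ℂ)) ^ 3 :=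
    ⟨fun z => 1 / (z + conj (w : ℂ)) ^ 3, (differentiableOn_const 1).div (by fun_prop)
      fun z hz => pow_ne_zero 3 (RightHalfPlane.add_conj_ne_zero ⟨z, hz⟩ w), fun _ => rfl⟩
  have hmem : (fun z : RightHalfPlane => 1 / ((z : ℂ) + conj (w : ℂ)) ^ 3) ∈ weightedBergman := by
    refine ⟨hholo, ((integrable_areaMeasure_iff _).2
      (integrableOn_weightedKernel_mul w.2 1)).norm.congr (ae_of_all _ fun z => ?_)⟩
    simp only [weightedKernel, norm_mul, RCLike.norm_conj, Complex.norm_real, pow_one,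
      Real.norm_of_nonneg z.2.le]
    ring
  convert ((memLp_rangeFactor_mul_iff hholo).2 hmem).const_mul (2 * conj (rangeFactor t w))
    using 2 with z
  rw [rangeKernel]
  ring

theorem inversionDensity_smul_mul_conj_rangeKernel (f : ℂ → ℂ) (z w : RightHalfPlane) :
    inversionDensity t z • (rangeFactor t z * f z * conj (rangeKernel t z w)) =
      4 / Real.pi * rangeFactor t w * (weightedKernel 1 w z • f z) := by
  have hfactor : (inversionDensity t z : ℂ) * (rangeFactor t z * conj (rangeFactor t z)) =
      2 / Real.pi * (z : ℂ).re := by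
    rw [Complex.mul_conj']
    exact_mod_cast inversionDensity_mul_norm_sq_rangeFactor z
  calc inversionDensity t z • (rangeFactor t z * f z * conj (rangeKernel t z w))
      = (inversionDensity t z : ℂ) * (rangeFactor t z * conj (rangeFactor t z)) *
          (f z * rangeFactor t w * conj (2 / ((z : ℂ) + conj (w : ℂ)) ^ 3)) := by
        rw [Complex.real_smul, rangeKernel, map_mul, map_mul, Complex.conj_conj]
        ring
    _ = 4 / Real.pi * rangeFactor t w * (weightedKernel 1 w z • f z) := by
        rw [hfactor, weightedKernel, pow_one, smul_eq_mul, map_div₀, map_div₀, map_one,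
          map_ofNat]
        ring

theorem integral_mul_conj_rangeKernel {F : RightHalfPlane → ℂ} (hF : F ∈ rangeSpace t)
    (w : RightHalfPlane) :
    ∫ z, F z * conj (rangeKernel t z w) ∂inversionMeasure t = F w := by
  have hint : Integrable (fun z => F z * conj (rangeKernel t z w)) (inversionMeasure t) :=
    (mem_rangeSpace_iff.1 hF).2.integrable_mul (memLp_rangeKernel w).star
  obtain ⟨f, ⟨⟨f', hf', hff'⟩, -⟩, rfl⟩ := mem_rangeSpace_iff_exists.1 hF
  have hpi : (Real.pi : ℂ) ≠ 0 := Complex.ofReal_ne_zero.2 Real.pi_ne_zero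
  have hunit : IsUnit (4 / Real.pi * rangeFactor t w) :=
    (mul_ne_zero (div_ne_zero (by norm_num) hpi) (rangeFactor_ne_zero w)).isUnit
  rw [integrable_inversionMeasure_iff] at hint
  rw [integral_inversionMeasure]
  simp only [hff', inversionDensity_smul_mul_conj_rangeKernel] at hint ⊢
  rw [integrable_const_mul_iff hunit,
    integrable_areaMeasure_iff fun z => weightedKernel 1 w z • f' z] at hint
  rw [integral_const_mul, integral_areaMeasure fun z => weightedKernel 1 w z • f' z,
    integral_weightedKernel_smul w.2 1 hf' hint, Complex.real_smul]
  push_cast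
  field_simp
  ring

end RangeKernel

section LaplaceIntegral

theorem norm_pow_mul_cexp_neg_mul (a : ℂ) (n : ℕ) {s : ℝ} (hs : 0 < s) :
    ‖(s : ℂ) ^ n * Complex.exp (-(a * s))‖ = s ^ (n : ℝ) * Real.exp (-a.re * s) := by
  rw [norm_mul, norm_pow, Complex.norm_real, Real.norm_of_nonneg hs.le, Complex.norm_exp,
    Complex.neg_re, Complex.re_mul_ofReal, neg_mul, Real.rpow_natCast]

theorem integrableOn_pow_mul_cexp_neg_mul {a : ℂ} (ha : 0 < a.re) (n : ℕ) :
    IntegrableOn (fun s : ℝ => (s : ℂ) ^ n * Complex.exp (-(a * s))) (Set.Ioi 0) := by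
  have hreal := integrableOn_rpow_mul_exp_neg_mul_rpow (s := n)
    (neg_one_lt_zero.trans_le n.cast_nonneg) one_pos ha
  simp only [Real.rpow_one] at hreal
  refine hreal.mono' (Measurable.aestronglyMeasurable (by fun_prop)) ?_
  filter_upwards [ae_restrict_mem measurableSet_Ioi] with s hs
  exact (norm_pow_mul_cexp_neg_mul a n hs).le

theorem tendsto_pow_mul_cexp_neg_mul {a : ℂ} (ha : 0 < a.re) (n : ℕ) :
    Tendsto (fun s : ℝ => (s : ℂ) ^ n * Complex.exp (-(a * s))) atTop (𝓝 0) := by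
  rw [tendsto_zero_iff_norm_tendsto_zero]
  refine (tendsto_rpow_mul_exp_neg_mul_atTop_nhds_zero n a.re ha).congr' ?_
  filter_upwards [eventually_gt_atTop 0] with s hs
  exact (norm_pow_mul_cexp_neg_mul a n hs).symm

theorem hasDerivAt_pow_succ_mul_cexp_neg_mul (a : ℂ) (n : ℕ) (s : ℝ) :
    HasDerivAt (fun s : ℝ => (s : ℂ) ^ (n + 1) * Complex.exp (-(a * s)))
      ((n + 1) * ((s : ℂ) ^ n * Complex.exp (-(a * s))) -
        a * ((s : ℂ) ^ (n + 1) * Complex.exp (-(a * s)))) s := by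
  have hid : HasDerivAt (fun s : ℝ => (s : ℂ)) 1 s := Complex.ofRealCLM.hasDerivAt
  convert! (hid.pow (n + 1)).mul (hid.const_mul a).neg.cexp using 1
  simp only [Pi.pow_apply, Pi.neg_apply, Nat.add_sub_cancel]
  push_cast
  ring

theorem integral_Ioi_pow_mul_cexp_neg_mul {a : ℂ} (ha : 0 < a.re) (n : ℕ) :
    ∫ s : ℝ in Set.Ioi 0, (s : ℂ) ^ n * Complex.exp (-(a * s)) = n.factorial / a ^ (n + 1) := by
  have ha0 : a ≠ 0 := fun h => ha.ne' (by simp [h])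
  induction n with
  | zero =>
    simpa [ha0, div_eq_mul_inv] using integral_exp_mul_complex_Ioi (a := -a) (by simpa) 0
  | succ n ih =>
    have hint := (integrableOn_pow_mul_cexp_neg_mul ha n).const_mul (n + 1 : ℂ)
    have hint' := (integrableOn_pow_mul_cexp_neg_mul ha (n + 1)).const_mul a
    have hparts := integral_Ioi_of_hasDerivAt_of_tendsto' (a := 0)
      (fun s _ => hasDerivAt_pow_succ_mul_cexp_neg_mul a n s)
      (hint.sub hint') (tendsto_pow_mul_cexp_neg_mul ha (n + 1))
    rw [integral_sub hint hint', integral_const_mul, integral_const_mul, ih] at hparts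
    have hmul : a * ∫ s : ℝ in Set.Ioi 0, (s : ℂ) ^ (n + 1) * Complex.exp (-(a * s)) =
        (n + 1) * (n.factorial / a ^ (n + 1)) := by
      refine (sub_eq_zero.1 (hparts.trans ?_)).symm
      simp
    rw [← mul_right_inj' ha0, hmul, Nat.factorial_succ]
    push_cast
    field_simp
    ring

end LaplaceIntegral

section SourceMeasure

instance (t : ℝ) : IsFiniteMeasure (sourceMeasure t) := by
  refine isFiniteMeasure_withDensity_ofReal (Integrable.hasFiniteIntegral ?_)
  exact ((by fun_prop : Continuous fun τ : ℝ => τ ^ 2 / t ^ 2).integrableOn_Icc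
    (a := 0) (b := t)).mono_set Set.Ioo_subset_Icc_self

theorem ae_sourceMeasure_mem_Ioo (t : ℝ) : ∀ᵐ τ ∂sourceMeasure t, τ ∈ Set.Ioo 0 t :=
  (withDensity_absolutelyContinuous _ _).ae_le (ae_restrict_mem measurableSet_Ioo)

variable {E : Type*} [NormedAddCommGroup E] [NormedSpace ℝ E] (t : ℝ) (f : ℝ → E)

theorem integrable_sourceMeasure_iff :
    Integrable f (sourceMeasure t) ↔
      IntegrableOn (fun τ => (τ ^ 2 / t ^ 2) • f τ) (Set.Ioo 0 t) := by
  have hnonneg (τ : ℝ) : 0 ≤ τ ^ 2 / t ^ 2 := by positivity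
  refine (integrable_withDensity_iff_integrable_smul' (by fun_prop) (by simp)).trans ?_
  simp only [ENNReal.toReal_ofReal (hnonneg _), IntegrableOn]

theorem integral_sourceMeasure :
    ∫ τ, f τ ∂sourceMeasure t = ∫ τ in Set.Ioo 0 t, (τ ^ 2 / t ^ 2) • f τ := by
  have hnonneg (τ : ℝ) : 0 ≤ τ ^ 2 / t ^ 2 := by positivity
  refine (integral_withDensity_eq_integral_toReal_smul (by fun_prop) (by simp) f).trans ?_
  simp only [ENNReal.toReal_ofReal (hnonneg _)]

end SourceMeasure

section LaplaceVariable

variable {t : ℝ}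

/-- The variable `s = 1/(t-τ) - 1/t`, which turns the transform into a Laplace transform on
`(0, ∞)`. -/
def laplaceVariable (t τ : ℝ) : ℝ := (t - τ)⁻¹ - t⁻¹

theorem laplaceVariable_eq_div {τ : ℝ} (ht : t ≠ 0) (hτ : τ ≠ t) :
    laplaceVariable t τ = τ / (t * (t - τ)) := by
  have := sub_ne_zero.2 hτ.symm
  rw [laplaceVariable]
  field_simp
  ring

theorem laplaceVariable_injective : Function.Injective (laplaceVariable t) :=
  (sub_left_injective.comp inv_injective).comp sub_right_injective

theorem measurableEmbedding_laplaceVariable : MeasurableEmbedding (laplaceVariable t) :=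
  Measurable.measurableEmbedding (by unfold laplaceVariable; fun_prop) laplaceVariable_injective

theorem hasDerivAt_laplaceVariable {τ : ℝ} (hτ : τ ≠ t) :
    HasDerivAt (laplaceVariable t) (((t - τ) ^ 2)⁻¹) τ :=
  ((((hasDerivAt_id τ).const_sub t).inv (sub_ne_zero.2 hτ.symm)).sub_const _).congr_deriv
    (by simp)

theorem laplaceVariable_image_Ioo (ht : 0 < t) :
    laplaceVariable t '' Set.Ioo 0 t = Set.Ioi 0 := by
  ext s
  constructor
  · rintro ⟨τ, hτ, rfl⟩
    rw [laplaceVariable_eq_div ht.ne' hτ.2.ne]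
    exact div_pos hτ.1 (mul_pos ht (sub_pos.2 hτ.2))
  · intro hs
    have hsum : 0 < s + t⁻¹ := add_pos hs (inv_pos.2 ht)
    refine ⟨t - (s + t⁻¹)⁻¹, ⟨sub_pos.2 ?_, sub_lt_self _ (inv_pos.2 hsum)⟩, ?_⟩
    · exact inv_lt_of_inv_lt₀ ht (lt_add_of_pos_left _ hs)
    · rw [laplaceVariable, sub_sub_cancel, inv_inv, add_sub_cancel_right]

theorem integral_Ioi_eq_integral_laplaceVariable {E : Type*} [NormedAddCommGroup E]
    [NormedSpace ℝ E] (ht : 0 < t) (f : ℝ → E) :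
    ∫ s in Set.Ioi 0, f s = ∫ τ in Set.Ioo 0 t, ((t - τ) ^ 2)⁻¹ • f (laplaceVariable t τ) := by
  rw [← laplaceVariable_image_Ioo ht, integral_image_eq_integral_abs_deriv_smul measurableSet_Ioo
    (fun τ hτ => (hasDerivAt_laplaceVariable hτ.2.ne).hasDerivWithinAt)
    laplaceVariable_injective.injOn]
  have hnonneg (τ : ℝ) : 0 ≤ ((t - τ) ^ 2)⁻¹ := by positivity
  simp only [abs_of_nonneg (hnonneg _)]

end LaplaceVariable

section LaplaceKernel

variable {t : ℝ}

/-- The kernel `z (t-τ)⁻² e^{-z/(t-τ)}` of the transform. -/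
def laplaceKernel (t : ℝ) (z : ℂ) (τ : ℝ) : ℂ :=
  z / ((t : ℂ) - τ) ^ 2 * Complex.exp (-(z / ((t : ℂ) - τ)))

theorem measurable_laplaceKernel :
    Measurable fun q : ℂ × ℝ => laplaceKernel t q.1 q.2 := by
  unfold laplaceKernel
  fun_prop

theorem measurable_laplaceKernel_right (z : ℂ) : Measurable (laplaceKernel t z) :=
  measurable_laplaceKernel.comp measurable_prodMk_left

theorem differentiable_laplaceKernel (τ : ℝ) : Differentiable ℂ fun z => laplaceKernel t z τ := by
  unfold laplaceKernel
  fun_prop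

theorem sq_mul_exp_neg_mul_le {r u : ℝ} (hr : 0 < r) (hu : 0 ≤ u) :
    u ^ 2 * Real.exp (-(r * u)) ≤ 2 / r ^ 2 := by
  have hexp := Real.pow_div_factorial_le_exp (r * u) (mul_nonneg hr.le hu) 2
  rw [Real.exp_neg, ← div_eq_mul_inv, div_le_div_iff₀ (Real.exp_pos _) (pow_pos hr 2)]
  rw [Nat.factorial_two, Nat.cast_ofNat, div_le_iff₀ two_pos] at hexp
  linarith [mul_pow r u 2]

theorem norm_laplaceKernel_le {z : ℂ} (hz : 0 < z.re) {τ : ℝ} (hτ : τ < t) :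
    ‖laplaceKernel t z τ‖ ≤ ‖z‖ * (2 / z.re ^ 2) := by
  have hu : 0 < (t - τ)⁻¹ := inv_pos.2 (sub_pos.2 hτ)
  have hker : laplaceKernel t z τ =
      z * (((t - τ)⁻¹ ^ 2 : ℝ) * Complex.exp (-(z * ((t - τ)⁻¹ : ℝ)))) := by
    rw [laplaceKernel]
    push_cast
    simp only [div_eq_mul_inv, inv_pow, mul_assoc]
  rw [hker, norm_mul, norm_mul, Complex.norm_exp, Complex.norm_real,
    Real.norm_of_nonneg (sq_nonneg _), Complex.neg_re, Complex.re_mul_ofReal]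
  gcongr
  exact sq_mul_exp_neg_mul_le hz hu.le

theorem continuousOn_norm_mul_two_div_re_sq :
    ContinuousOn (fun z : ℂ => ‖z‖ * (2 / z.re ^ 2)) {z | 0 < z.re} :=
  continuous_norm.continuousOn.mul (continuousOn_const.div (by fun_prop)
    fun _ hz => pow_ne_zero 2 (ne_of_gt hz))

theorem laplaceKernel_eq_rangeFactor_mul (z : RightHalfPlane) (τ : ℝ) :
    laplaceKernel t z τ = rangeFactor t z *
      ((((t - τ) ^ 2)⁻¹ : ℝ) * Complex.exp (-((z : ℂ) * laplaceVariable t τ))) := by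
  have hexp : Complex.exp (-((z : ℂ) / ((t : ℂ) - τ))) =
      Complex.exp (-(z : ℂ) / t) * Complex.exp (-((z : ℂ) * laplaceVariable t τ)) := by
    rw [← Complex.exp_add, laplaceVariable]
    push_cast
    ring_nf
  rw [laplaceKernel, hexp, rangeFactor]
  push_cast
  ring

theorem sourceDensity_smul_laplaceKernel_mul_conj (ht : t ≠ 0) (z w : RightHalfPlane) {τ : ℝ}
    (hτ : τ ≠ t) :
    (τ ^ 2 / t ^ 2) • (laplaceKernel t z τ * conj (laplaceKernel t w τ)) =
      rangeFactor t z * conj (rangeFactor t w) * (((t - τ) ^ 2)⁻¹ •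
        ((laplaceVariable t τ : ℂ) ^ 2 *
          Complex.exp (-(((z : ℂ) + conj (w : ℂ)) * laplaceVariable t τ)))) := by
  have hweight : (τ ^ 2 / t ^ 2) * ((t - τ) ^ 2)⁻¹ = laplaceVariable t τ ^ 2 := by
    rw [laplaceVariable_eq_div ht hτ, ← div_eq_mul_inv, div_div, div_pow, mul_pow]
  have hexp : Complex.exp (-(((z : ℂ) + conj (w : ℂ)) * laplaceVariable t τ)) =
      Complex.exp (-((z : ℂ) * laplaceVariable t τ)) *
        conj (Complex.exp (-((w : ℂ) * laplaceVariable t τ))) := by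
    rw [← Complex.exp_conj, ← Complex.exp_add, map_neg, map_mul, Complex.conj_ofReal]
    ring_nf
  rw [hexp, ← Complex.ofReal_pow, ← hweight, laplaceKernel_eq_rangeFactor_mul,
    laplaceKernel_eq_rangeFactor_mul, Complex.real_smul, Complex.real_smul]
  simp only [map_mul, Complex.conj_ofReal]
  push_cast
  ring

theorem integral_laplaceKernel_mul_conj (ht : 0 < t) (z w : RightHalfPlane) :
    ∫ τ, laplaceKernel t z τ * conj (laplaceKernel t w τ) ∂sourceMeasure t =
      rangeKernel t z w := by
  have hre : 0 < ((z : ℂ) + conj (w : ℂ)).re := by simpa using add_pos z.2 w.2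
  rw [integral_sourceMeasure, setIntegral_congr_fun measurableSet_Ioo fun τ hτ =>
    sourceDensity_smul_laplaceKernel_mul_conj ht.ne' z w hτ.2.ne, integral_const_mul,
    ← integral_Ioi_eq_integral_laplaceVariable ht fun s : ℝ =>
      (s : ℂ) ^ 2 * Complex.exp (-(((z : ℂ) + conj (w : ℂ)) * s)),
    integral_Ioi_pow_mul_cexp_neg_mul hre, rangeKernel, Nat.factorial_two,
    Nat.cast_ofNat]

end LaplaceKernel

section LaplaceVector

variable {t : ℝ}

theorem memLp_conj_laplaceKernel (t : ℝ) (z : RightHalfPlane) :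
    MemLp (fun τ => conj (laplaceKernel t z τ)) 2 (sourceMeasure t) := by
  refine MemLp.of_bound (measurable_laplaceKernel_right z.1).aestronglyMeasurable.star
    (‖(z : ℂ)‖ * (2 / (z : ℂ).re ^ 2)) ?_
  filter_upwards [ae_sourceMeasure_mem_Ioo t] with τ hτ
  exact (RCLike.norm_conj _).trans_le (norm_laplaceKernel_le z.2 hτ.2)

/-- The vector of `L²` that represents the evaluation of the transform at `z`. -/
def laplaceVector (t : ℝ) (z : RightHalfPlane) : Lp ℂ 2 (sourceMeasure t) :=
  (memLp_conj_laplaceKernel t z).toLp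

theorem coeFn_laplaceVector (z : RightHalfPlane) :
    laplaceVector t z =ᵐ[sourceMeasure t] fun τ => conj (laplaceKernel t z τ) :=
  (memLp_conj_laplaceKernel t z).coeFn_toLp

theorem inner_laplaceVector_ae_eq (z : RightHalfPlane) (g : Lp ℂ 2 (sourceMeasure t)) :
    (fun τ => inner ℂ (laplaceVector t z τ) (g τ)) =ᵐ[sourceMeasure t]
      fun τ => laplaceKernel t z τ * g τ := by
  filter_upwards [coeFn_laplaceVector z] with τ hτ
  rw [hτ, RCLike.inner_apply, Complex.conj_conj, mul_comm]

theorem integrable_laplaceKernel_mul (z : RightHalfPlane) (g : Lp ℂ 2 (sourceMeasure t)) :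
    Integrable (fun τ => laplaceKernel t z τ * g τ) (sourceMeasure t) :=
  (L2.integrable_inner (laplaceVector t z) g).congr (inner_laplaceVector_ae_eq z g)

theorem inner_laplaceVector (z : RightHalfPlane) (g : Lp ℂ 2 (sourceMeasure t)) :
    inner ℂ (laplaceVector t z) g = ∫ τ, laplaceKernel t z τ * g τ ∂sourceMeasure t :=
  integral_congr_ae (inner_laplaceVector_ae_eq z g)

theorem transformIntegrand_eq (ht : t ≠ 0) (g : ℝ → ℂ) (z : RightHalfPlane) (τ : ℝ) :
    transformIntegrand t g z τ =
      (t : ℂ) ^ 2 * ((τ ^ 2 / t ^ 2) • (laplaceKernel t z τ * g τ)) := by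
  have : (t : ℂ) ≠ 0 := Complex.ofReal_ne_zero.2 ht
  rw [transformIntegrand, laplaceKernel, Complex.real_smul]
  push_cast
  field_simp

theorem integrableOn_transformIntegrand (ht : t ≠ 0) (g : Lp ℂ 2 (sourceMeasure t))
    (z : RightHalfPlane) : IntegrableOn (transformIntegrand t g z) (Set.Ioo 0 t) := by
  rw [funext (transformIntegrand_eq ht g z)]
  exact ((integrable_sourceMeasure_iff t _).1 (integrable_laplaceKernel_mul z g)).const_mul _

theorem inner_laplaceVector_eq_transform (ht : t ≠ 0) (z : RightHalfPlane)
    (g : Lp ℂ 2 (sourceMeasure t)) : inner ℂ (laplaceVector t z) g = transform t g z := by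
  have : (t : ℂ) ^ 2 ≠ 0 := pow_ne_zero 2 (Complex.ofReal_ne_zero.2 ht)
  rw [inner_laplaceVector, integral_sourceMeasure, transform,
    funext (transformIntegrand_eq ht g z), integral_const_mul, one_div, inv_mul_cancel_left₀ this]

theorem inner_laplaceVector_laplaceVector (ht : 0 < t) (z w : RightHalfPlane) :
    inner ℂ (laplaceVector t z) (laplaceVector t w) = rangeKernel t z w := by
  rw [inner_laplaceVector, ← integral_laplaceKernel_mul_conj ht]
  refine integral_congr_ae ?_
  filter_upwards [coeFn_laplaceVector w] with τ hτ
  rw [hτ]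

theorem isHolomorphic_coefficientMap_laplaceVector (g : Lp ℂ 2 (sourceMeasure t)) :
    IsHolomorphic (coefficientMap ℂ (laplaceVector t) g) := by
  refine ⟨fun z => ∫ τ, laplaceKernel t z τ * g τ ∂sourceMeasure t,
    differentiableOn_integral_of_locally_dominated (Complex.isOpen_re_gt 0) ?_ ?_ ?_,
    fun z => inner_laplaceVector z g⟩
  · exact fun z _ =>
      (measurable_laplaceKernel_right z).aestronglyMeasurable.mul (Lp.aestronglyMeasurable g)
  · exact ae_of_all _ fun τ => ((differentiable_laplaceKernel τ).mul_const _).differentiableOn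
  · intro z hz
    have hU : {w : ℂ | 0 < w.re} ∈ 𝓝 z := (Complex.isOpen_re_gt 0).mem_nhds hz
    have hnear := (continuousOn_norm_mul_two_div_re_sq.continuousAt hU).eventually_lt_const
      (lt_add_one _)
    refine ⟨_, inter_mem hU hnear, _, ((Lp.memLp g).integrable one_le_two).norm.const_mul
      (‖z‖ * (2 / z.re ^ 2) + 1), ?_⟩
    filter_upwards [ae_sourceMeasure_mem_Ioo t] with τ hτ w hw
    rw [norm_mul]
    gcongr
    exact (norm_laplaceKernel_le hw.1 hτ.2).trans (le_of_lt hw.2)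

theorem eq_zero_of_inner_laplaceVector_eq_zero {g : Lp ℂ 2 (sourceMeasure t)}
    (h : ∀ z, inner ℂ (laplaceVector t z) g = 0) : g = 0 := by
  let z (y : ℝ) : RightHalfPlane := ⟨1 - y * Complex.I, by simp⟩
  let f (τ : ℝ) : ℂ := (((t - τ) ^ 2)⁻¹ : ℝ) * Complex.exp (-(laplaceVariable t τ)) * g τ
  have hf (y τ : ℝ) : laplaceKernel t (z y) τ * g τ =
      rangeFactor t (z y) * (Complex.exp (y * laplaceVariable t τ * Complex.I) • f τ) := by
    have hexp : Complex.exp (-((z y : ℂ) * laplaceVariable t τ)) =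
        Complex.exp (y * laplaceVariable t τ * Complex.I) *
          Complex.exp (-(laplaceVariable t τ)) := by
      rw [← Complex.exp_add, show (z y : ℂ) = 1 - y * Complex.I from rfl]
      ring_nf
    rw [laplaceKernel_eq_rangeFactor_mul, hexp, smul_eq_mul]
    ring
  have hint : Integrable f (sourceMeasure t) := by
    have hunit := (rangeFactor_ne_zero (t := t) (z 0)).isUnit
    simpa [hf, integrable_const_mul_iff hunit] using integrable_laplaceKernel_mul (z 0) g
  have hzero : f =ᵐ[sourceMeasure t] 0 := by
    refine ae_eq_zero_of_integral_cexp_comp_eq_zero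
      (measurableEmbedding_laplaceVariable (t := t)) hint fun y => ?_
    have hinner := h (z y)
    simp only [inner_laplaceVector, hf, integral_const_mul] at hinner
    exact (mul_eq_zero.1 hinner).resolve_left (rangeFactor_ne_zero _)
  rw [Lp.eq_zero_iff_ae_eq_zero]
  filter_upwards [hzero, ae_sourceMeasure_mem_Ioo t] with τ hfτ hτ
  have hne : ((((t - τ) ^ 2)⁻¹ : ℝ) : ℂ) ≠ 0 :=
    Complex.ofReal_ne_zero.2 (inv_ne_zero (pow_ne_zero 2 (sub_ne_zero.2 hτ.2.ne')))
  exact (mul_eq_zero.1 hfτ).resolve_left (mul_ne_zero hne (Complex.exp_ne_zero _))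

theorem dense_span_laplaceVector :
    Dense (Submodule.span ℂ (Set.range (laplaceVector t)) : Set (Lp ℂ 2 (sourceMeasure t))) := by
  rw [Submodule.dense_iff_topologicalClosure_eq_top, Submodule.topologicalClosure_eq_top_iff,
    Submodule.eq_bot_iff]
  exact fun g hg => eq_zero_of_inner_laplaceVector_eq_zero fun z =>
    (Submodule.mem_orthogonal _ g).1 hg _ (Submodule.subset_span (Set.mem_range_self z))

theorem isReproducingSpace_rangeSpace (ht : 0 < t) :
    IsReproducingSpace (laplaceVector t) (inversionMeasure t) (rangeSpace t) where
  memLp _ hF := (mem_rangeSpace_iff.1 hF).2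
  mem_of_memLp g hg := mem_rangeSpace_iff.2 ⟨isHolomorphic_coefficientMap_laplaceVector g, hg⟩
  memLp_kernel w := by
    simpa only [inner_laplaceVector_laplaceVector ht, funext (coefficientMap_apply _ _)]
      using memLp_rangeKernel w
  reproducing F hF w := by
    simpa only [inner_laplaceVector_laplaceVector ht] using integral_mul_conj_rangeKernel hF w
  dense_span := dense_span_laplaceVector

end LaplaceVector

section TruncatedInverse

variable {t : ℝ}

theorem truncatedInverse_eq (t : ℝ) (F : RightHalfPlane → ℂ) {E : Set RightHalfPlane}
    (hE : MeasurableSet E) :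
    truncatedInverse t F E =
      fun τ => ∫ z, E.indicator F z * conj (laplaceKernel t z τ) ∂inversionMeasure t := by
  ext τ
  have hindicator : (fun z => E.indicator F z * conj (laplaceKernel t z τ)) =
      E.indicator fun z => F z * conj (laplaceKernel t z τ) := by
    ext z
    by_cases hz : z ∈ E <;> simp [hz]
  rw [hindicator, integral_indicator hE, truncatedInverse, ← integral_const_mul]
  congr 1 with z
  simp only [inversionIntegrand, laplaceKernel, map_mul, map_div₀, map_pow, map_sub,
    Complex.conj_ofReal, ← Complex.exp_conj, map_neg]
  ring

theorem continuous_inversionIntegrand {F : RightHalfPlane → ℂ} (hF : Continuous F) (τ : ℝ) :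
    Continuous (inversionIntegrand t F τ) := by
  unfold inversionIntegrand
  fun_prop

theorem aestronglyMeasurable_indicator_mul_conj_laplaceKernel {F : RightHalfPlane → ℂ}
    (hF : Continuous F) {E : Set RightHalfPlane} (hE : MeasurableSet E) :
    AEStronglyMeasurable
      (Function.uncurry fun (τ : ℝ) (z : RightHalfPlane) =>
        E.indicator F z * conj (laplaceKernel t z τ))
      ((sourceMeasure t).prod (inversionMeasure t)) := by
  have hker : Measurable fun q : ℝ × RightHalfPlane => laplaceKernel t q.2 q.1 :=
    measurable_laplaceKernel.comp
      ((measurable_subtype_coe.comp measurable_snd).prodMk measurable_fst)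
  exact ((hF.measurable.indicator hE).comp measurable_snd).aestronglyMeasurable.mul
    hker.aestronglyMeasurable.star

theorem integrable_indicator_norm_mul {F : RightHalfPlane → ℂ} (hF : Continuous F)
    {E : Set RightHalfPlane} (hE : IsCompact E) :
    Integrable (fun z : RightHalfPlane =>
      ‖E.indicator F z‖ * (‖(z : ℂ)‖ * (2 / (z : ℂ).re ^ 2))) (inversionMeasure t) := by
  have hcont : Continuous fun z : RightHalfPlane => ‖F z‖ * (‖(z : ℂ)‖ * (2 / (z : ℂ).re ^ 2)) :=
    hF.norm.mul (continuousOn_norm_mul_two_div_re_sq.comp_continuous continuous_subtype_val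
      fun z => z.2)
  refine ((integrable_indicator_iff hE.measurableSet).2
    (hcont.continuousOn.integrableOn_compact hE)).congr (ae_of_all _ fun z => ?_)
  by_cases hz : z ∈ E <;> simp [hz]

theorem ae_norm_indicator_mul_conj_laplaceKernel_le (F : RightHalfPlane → ℂ)
    (E : Set RightHalfPlane) :
    ∀ᵐ q ∂(sourceMeasure t).prod (inversionMeasure t),
      ‖E.indicator F q.2 * conj (laplaceKernel t q.2 q.1)‖ ≤
        ‖E.indicator F q.2‖ * (‖(q.2 : ℂ)‖ * (2 / (q.2 : ℂ).re ^ 2)) := by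
  filter_upwards [Measure.quasiMeasurePreserving_fst.ae (ae_sourceMeasure_mem_Ioo t)] with q hq
  rw [norm_mul, RCLike.norm_conj]
  gcongr
  exact norm_laplaceKernel_le q.2.2 hq.2

theorem memLp_truncatedInverse {F : RightHalfPlane → ℂ} (hF : Continuous F)
    {E : Set RightHalfPlane} (hE : IsCompact E) (p : ℝ≥0∞) :
    MemLp (truncatedInverse t F E) p (sourceMeasure t) := by
  rw [truncatedInverse_eq t F hE.measurableSet]
  exact memLp_integral_of_norm_le
    (aestronglyMeasurable_indicator_mul_conj_laplaceKernel hF hE.measurableSet)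
    (integrable_indicator_norm_mul hF hE) (ae_norm_indicator_mul_conj_laplaceKernel_le F E) p

theorem adjoint_toLp_indicator_eq_truncatedInverse (ht : 0 < t) {F : RightHalfPlane → ℂ}
    (hF : Continuous F) (hFp : MemLp F 2 (inversionMeasure t)) {E : Set RightHalfPlane}
    (hE : IsCompact E) :
    ContinuousLinearMap.adjoint (isReproducingSpace_rangeSpace ht).toLpCLM
        (hFp.indicator hE.measurableSet).toLp =
      (memLp_truncatedInverse hF hE 2).toLp (truncatedInverse t F E) := by
  have hT (g : Lp ℂ 2 (sourceMeasure t)) :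
      (isReproducingSpace_rangeSpace ht).toLpCLM g =ᵐ[inversionMeasure t]
        fun z => ∫ τ, laplaceKernel t z τ * g τ ∂sourceMeasure t := by
    filter_upwards [(isReproducingSpace_rangeSpace ht).coeFn_toLpCLM g] with z hz
    rw [hz, coefficientMap_apply, inner_laplaceVector]
  have hint (g : Lp ℂ 2 (sourceMeasure t)) := integrable_prod_mul_of_norm_le
    (aestronglyMeasurable_indicator_mul_conj_laplaceKernel hF hE.measurableSet)
    (integrable_indicator_norm_mul hF hE) (ae_norm_indicator_mul_conj_laplaceKernel_le F E)
    ((Lp.memLp g).star.integrable one_le_two)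
  have htrunc := truncatedInverse_eq t F hE.measurableSet
  have hmem := memLp_truncatedInverse (t := t) hF hE 2
  rw [htrunc] at hmem
  rw [adjoint_toLp_eq_toLp_integral hT (hFp.indicator hE.measurableSet) hmem hint]
  exact MemLp.toLp_congr _ _ (ae_of_all _ (congr_fun htrunc.symm))

end TruncatedInverse

end

theorem mainTheorem4 (t : ℝ) (ht : 0 < t) :
    (∀ (g : Lp ℂ 2 (sourceMeasure t)) (z : RightHalfPlane),
      IntegrableOn (transformIntegrand t g z) (Set.Ioo 0 t) volume) ∧
    ∃ Φ : Lp ℂ 2 (sourceMeasure t) ≃ₗ[ℂ] rangeSpace t,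
      (∀ (g : Lp ℂ 2 (sourceMeasure t)) (z : RightHalfPlane),
        (Φ g : RightHalfPlane → ℂ) z = transform t g z) ∧
      (∀ g : Lp ℂ 2 (sourceMeasure t), rangeNorm t (Φ g) = ‖g‖) ∧
      ∀ (F : rangeSpace t) (E : CompactExhaustion RightHalfPlane),
        (∀ N : ℕ, ∀ τ ∈ Set.Ioo 0 t,
          IntegrableOn (inversionIntegrand t F τ) (E N) (inversionMeasure t)) ∧
        ∃ hE : ∀ N : ℕ, MemLp (truncatedInverse t F (E N)) 2 (sourceMeasure t),
          Tendsto (fun N : ℕ => (hE N).toLp (truncatedInverse t F (E N))) atTop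
            (𝓝 (Φ.symm F)) := by
  have h := isReproducingSpace_rangeSpace ht
  refine ⟨integrableOn_transformIntegrand ht.ne', h.equiv, fun g z => ?_, fun g => ?_,
    fun F E => ?_⟩
  · exact (h.equiv_apply g z).trans (inner_laplaceVector_eq_transform ht.ne' z g)
  · obtain ⟨hF, hFp⟩ := mem_rangeSpace_iff.1 (h.equiv g).2
    rw [rangeNorm_eq_lpNorm hF, ← h.norm_toLpCLM g, ← toReal_eLpNorm hFp.1]
    exact (Lp.norm_toLp _ hFp).symm
  · obtain ⟨hF, hFp⟩ := mem_rangeSpace_iff.1 F.2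
    refine ⟨fun N τ _ => (continuous_inversionIntegrand hF.continuous τ).continuousOn
      |>.integrableOn_compact (E.isCompact N),
      fun N => memLp_truncatedInverse hF.continuous (E.isCompact N) 2, ?_⟩
    have hmem : ∀ᵐ z ∂inversionMeasure t, ∀ᶠ N in atTop, z ∈ E N :=
      ae_of_all _ fun z => (eventually_ge_atTop (E.find z)).mono fun _ => E.mem_iff_find_le.2
    have hlim := tendsto_toLp_indicator ENNReal.ofNat_ne_top
      (fun N => (E.isCompact N).measurableSet) hmem hFp
    rw [h.equiv_symm_apply]
    exact (((ContinuousLinearMap.adjoint h.toLpCLM).continuous.tendsto _).comp hlim).congr fun N =>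
      adjoint_toLp_indicator_eq_truncatedInverse ht hF.continuous hFp (E.isCompact N)
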